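/- **Setting.** Let $m\ge 0$ be an integer and let $D_m$ be the space of càdlàg paths $x:[0,\infty)\to\mathbb R^m$, with $x(0-):=x(0)$ and $\Delta x(t):=x(t)-x(t-)$. Write $x_t(s)=x(s\wedge t)$, and $x_{t-}(s)=x(s)$ for $s<t$, $x_{t-}(s)=x(t-)$ for $s\ge t$. Let $\pi=(\pi_n)$ be a sequence of finite partitions $0=t^n_0<\dots<t^n_{k_n}$ with $t^n_{k_n}\to\infty$ and with mesh tending to $0$ on every compact interval. For $x\in D_m$ put $x^n:=\sum_{i<k_n}x(t^n_{i+1})\mathbf 1_{[t^n_i,t^n_{i+1})}$, let $x^{(n)}$ be the continuous piecewise-linear interpolation of $x$ at the points of $\pi_n$ (constant after $t^n_{k_n}$), and put $t'_n:=\max\{t_i\in\pi_n: t_i<t\}$ ($:=0$ if there is no such point). The path $x$ has quadratic variation $[x]$ along $\pi$ if $q_n(t):=\sum_{i<k_n,\,t^n_i\le t}(x(t^n_{i+1})-x(t^n_i))(x(t^n_{i+1})-x(t^n_i))'$ converges to $[x]$ in the Skorokhod J$_1$ topology on $\mathbb R^{m\times m}$-valued càdlàg paths. A non-empty set $\Omega\subset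 D_m$ is *generic* if (i) for all $x\in\Omega$, $T>0$ one has $(x^n)_T\in\Omega$ for all large $n$; (ii) for all $x\in\Omega$, $t\ge0$ there is a convex neighbourhood $\mathcal U$ of $0$ in $\mathbb R^m$ with $-\Delta x(t)\in\mathcal U$ and $x_t+e\mathbf 1_{[t,\infty)}\in\Omega$ for all $e\in\mathcal U$. Assume that $\Omega$ is generic and contains a path $x$ which has a quadratic variation $[x]$ along $\pi$ that is continuous and strictly increasing (for $s<t$, $[x](t)-[x](s)$ is positive semidefinite and non-zero), together with its approximations $x^{(n)}$ for all large $n$. Let $\Lambda:=\{(t,x_t): t\ge0,\ x\in\Omega\}\subset[0,\infty)\times D_m$. The J$_1$ topology and the uniform (U) topology on $\Lambda$ are those induced by the product of the usual topology of $[0,\infty)$ with the Skorokhod J$_1$ topology, respectively the topology of locally uniform convergence, on $D_m$. The *$\pi$-topology* on $\Lambda$ is the initial topology generated by the set $\mathfrak X$ of all $F:\Lambda\to\mathbb R$ such that for all $x\in\Omega$, $t\ge0$ and all sequences $u_n\to t$ in $[0,\infty)$ (inequalities between $u_n$ and $t'_n$ being required for all large $n$): 1. (a) $F(s,x_{s-})\to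 F(t,x_{t-})$ as $s\uparrow t$, $s\le t$; (b) $F(s,x_s)\to F(t,x_{t-})$ as $s\uparrow t$, $s<t$; (c) $F(u_n,x^n_{u_n-})\to F(t,x_{t-})$ if $u_n\le t'_n$; (d) $F(u_n,x^n_{u_n})\to F(t,x_{t-})$ if $u_n<t'_n$; 2. (a) $F(s,x_s)\to F(t,x_t)$ as $s\downarrow t$, $s\ge t$; (b) $F(s,x_{s-})\to F(t,x_t)$ as $s\downarrow t$, $s>t$; (c) $F(u_n,x^n_{u_n})\to F(t,x_t)$ if $u_n\ge t'_n$; (d) $F(u_n,x^n_{u_n-})\to F(t,x_t)$ if $u_n>t'_n$. (All arguments lie in $\Lambda$, those with an index $n$ for all large $n$.) **Theorem.** Under these assumptions: 1. every J$_1$-continuous functional $F:\Lambda\to\mathbb R$ is $\pi$-continuous; 2. there is a $\pi$-continuous functional $F:\Lambda\to\mathbb R$ that is not U-continuous; 3. there is a U-continuous functional $F:\Lambda\to\mathbb R$ that is not $\pi$-continuous. Moreover the $\pi$-topology on $\Lambda$ is strictly finer than the J$_1$ topology, and neither of the $\pi$-topology and the U topology is finer than the other. -/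

import Mathlib

open Filter Topology Set
open scoped NNReal

attribute [local instance] Matrix.frobeniusNormedAddCommGroup

namespace CausalCalculus

/-! ### Càdlàg paths -/

/-- Right-continuous with left limits on `[0, ∞)`. -/
def IsCadlag {E : Type*} [NormedAddCommGroup E] (x : ℝ≥0 → E) : Prop :=
  ∀ t, ContinuousWithinAt x (Ici t) t ∧ ∃ l, Tendsto x (𝓝[<] t) (𝓝 l)

section helpers

variable {E : Type*} [NormedAddCommGroup E]

theorem isCadlag_of_continuous {x : ℝ≥0 → E} (hx : Continuous x) : IsCadlag x :=
  fun t => ⟨hx.continuousWithinAt, x t, hx.continuousWithinAt⟩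

theorem IsCadlag.add {x y : ℝ≥0 → E} (hx : IsCadlag x) (hy : IsCadlag y) :
    IsCadlag (fun s => x s + y s) := by
  intro t
  obtain ⟨hx1, l, hl⟩ := hx t
  obtain ⟨hy1, l', hl'⟩ := hy t
  exact ⟨hx1.add hy1, l + l', hl.add hl'⟩

theorem isCadlag_sum {ι : Type*} (S : Finset ι) (x : ι → ℝ≥0 → E)
    (hx : ∀ i, IsCadlag (x i)) : IsCadlag (fun s => ∑ i ∈ S, x i s) := by
  intro t
  refine ⟨?_, ∑ i ∈ S, ((hx i) t).2.choose, ?_⟩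
  · exact tendsto_finsetSum _ fun i _ => ((hx i) t).1
  · exact tendsto_finsetSum _ fun i _ => ((hx i) t).2.choose_spec

/-- Gluing two càdlàg paths at time `t`. -/
theorem isCadlag_glue {x y : ℝ≥0 → E} (hx : IsCadlag x) (hy : IsCadlag y) (t : ℝ≥0) :
    IsCadlag (fun s => if s < t then x s else y s) := by
  intro u
  rcases lt_trichotomy u t with h | h | h
  · have hev : (fun s => if s < t then x s else y s) =ᶠ[𝓝 u] x := by
      filter_upwards [Iio_mem_nhds h] with s hs
      exact if_pos hs
    obtain ⟨h1, l, hl⟩ := hx u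
    refine ⟨?_, l, ?_⟩
    · exact h1.congr_of_eventuallyEq (hev.filter_mono nhdsWithin_le_nhds) hev.self_of_nhds
    · exact hl.congr' (hev.symm.filter_mono nhdsWithin_le_nhds)
  · subst h
    refine ⟨?_, (hx u).2.choose, ?_⟩
    · refine (hy u).1.congr (fun s hs => ?_) ?_
      · exact if_neg (not_lt.2 hs)
      · exact if_neg (lt_irrefl _)
    · refine (hx u).2.choose_spec.congr' ?_
      filter_upwards [self_mem_nhdsWithin] with s hs
      exact (if_pos hs).symm
  · have hev : (fun s => if s < t then x s else y s) =ᶠ[𝓝 u] y := by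
      filter_upwards [Ioi_mem_nhds h] with s hs
      exact if_neg (not_lt.2 (le_of_lt hs))
    obtain ⟨h1, l, hl⟩ := hy u
    refine ⟨?_, l, ?_⟩
    · exact h1.congr_of_eventuallyEq (hev.filter_mono nhdsWithin_le_nhds) hev.self_of_nhds
    · exact hl.congr' (hev.symm.filter_mono nhdsWithin_le_nhds)

theorem isCadlag_const (c : E) : IsCadlag (fun _ : ℝ≥0 => c) :=
  isCadlag_of_continuous continuous_const

theorem isCadlag_indicator_Ici (t : ℝ≥0) (c : E) :
    IsCadlag ((Ici t).indicator fun _ => c) := by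
  have h := isCadlag_glue (isCadlag_const (0 : E)) (isCadlag_const c) t
  convert h using 1
  funext s
  by_cases hs : s < t
  · simp [hs]
  · simp [hs, not_lt.1 hs]

theorem isCadlag_indicator_Ico (a b : ℝ≥0) (c : E) :
    IsCadlag ((Ico a b).indicator fun _ => c) := by
  have h := isCadlag_glue (isCadlag_indicator_Ici a c) (isCadlag_const (0 : E)) b
  convert h using 1
  funext s
  by_cases hs : s < b
  · by_cases ha : a ≤ s <;> simp [hs, ha]
  · simp [hs]

end helpers

/-- The space `D` of `E`-valued càdlàg paths on `[0, ∞)`. It carries no default topology. -/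
@[ext]
structure CadlagPath (E : Type*) [NormedAddCommGroup E] where
  toFun : ℝ≥0 → E
  cadlag : IsCadlag toFun

instance {E : Type*} [NormedAddCommGroup E] : CoeFun (CadlagPath E) (fun _ => ℝ≥0 → E) :=
  ⟨CadlagPath.toFun⟩

section paths

variable {E : Type*} [NormedAddCommGroup E]

/-- The left limit `x(t-)`, with `x(0-) = x(0)`. -/
noncomputable def CadlagPath.left (x : CadlagPath E) (t : ℝ≥0) : E := Function.leftLim x.toFun t

/-- The jump `Δx(t) = x(t) - x(t-)`. -/
noncomputable def CadlagPath.jump (x : CadlagPath E) (t : ℝ≥0) : E := x t - x.left t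

/-- The path `x_t` stopped at `t`: `x_t(s) = x(s ∧ t)`. -/
def CadlagPath.stopAt (x : CadlagPath E) (t : ℝ≥0) : CadlagPath E where
  toFun s := x (min s t)
  cadlag := by
    have h := isCadlag_glue x.cadlag (isCadlag_const (x t)) t
    convert h using 1
    funext s
    by_cases hs : s < t
    · simp [hs, hs.le]
    · simp [hs, not_lt.1 hs]

/-- The path `x_{t-}` stopped just before `t`: `x(s)` for `s < t` and `x(t-)` for `s ≥ t`. -/
noncomputable def CadlagPath.stopBefore (x : CadlagPath E) (t : ℝ≥0) : CadlagPath E where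
  toFun s := if s < t then x s else x.left t
  cadlag := isCadlag_glue x.cadlag (isCadlag_const _) t

/-- The vertical perturbation `x_t + e 1_{[t, ∞)}`. -/
noncomputable def CadlagPath.perturb (x : CadlagPath E) (t : ℝ≥0) (e : E) : CadlagPath E where
  toFun s := x.stopAt t s + (Ici t).indicator (fun _ => e) s
  cadlag := (x.stopAt t).cadlag.add (isCadlag_indicator_Ici t e)

/-! ### The Skorokhod J₁ topology and the local uniform topology on paths -/

/-- The basic J₁ entourage: `y` is within `ε` of `x` on `[0, T]` after a change of time `lam`
(an increasing bijection of `[0, ∞)`) that moves no instant by more than `ε`. -/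
def jOneEntourage (T : ℝ≥0) (ε : ℝ) : Set (CadlagPath E × CadlagPath E) :=
  {p | ∃ lam : ℝ≥0 ≃o ℝ≥0, (∀ s, dist (lam s) s ≤ ε) ∧
    ∀ s ≤ T, dist (p.1 s) (p.2 (lam s)) ≤ ε}

theorem jOneEntourage_mono {T T' : ℝ≥0} {ε ε' : ℝ} (hT : T' ≤ T) (hε : ε ≤ ε') :
    jOneEntourage (E := E) T ε ⊆ jOneEntourage T' ε' := by
  rintro p ⟨lam, h1, h2⟩
  exact ⟨lam, fun s => (h1 s).trans hε, fun s hs => (h2 s (hs.trans hT)).trans hε⟩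

theorem le_add_of_dist_le_one {a b T : ℝ≥0} (h : dist a b ≤ 1) (hb : b ≤ T) : a ≤ T + 1 := by
  rw [NNReal.dist_eq] at h
  have h1 := (abs_le.1 h).2
  have h2 : (b : ℝ) ≤ T := hb
  have : (a : ℝ) ≤ (T + 1 : ℝ≥0) := by push_cast; linarith
  exact_mod_cast this

/-- The uniform structure of the J₁ topology. A sequence `x_n` converges to `x` iff there are time
changes `lam_n` with `sup_s |lam_n s - s| → 0` and `sup_{s ≤ T} |x_n (lam_n s) - x s| → 0` for
every `T`. -/
@[reducible]
def jOneUniformSpace (E : Type*) [NormedAddCommGroup E] : UniformSpace (CadlagPath E) :=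
  UniformSpace.ofCore <| UniformSpace.Core.mkOfBasis
    { sets := {V | ∃ T : ℝ≥0, ∃ ε : ℝ, 0 < ε ∧ V = jOneEntourage T ε}
      nonempty := ⟨_, 0, 1, one_pos, rfl⟩
      inter_sets := by
        rintro _ _ ⟨T, ε, hε, rfl⟩ ⟨T', ε', hε', rfl⟩
        exact ⟨_, ⟨max T T', min ε ε', lt_min hε hε', rfl⟩, subset_inter
          (jOneEntourage_mono (le_max_left _ _) (min_le_left _ _))
          (jOneEntourage_mono (le_max_right _ _) (min_le_right _ _))⟩ }
    (by
      rintro _ ⟨T, ε, hε, rfl⟩ x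
      exact ⟨OrderIso.refl _, fun s => by simpa using hε.le, fun s _ => by simpa using hε.le⟩)
    (by
      rintro _ ⟨T, ε, hε, rfl⟩
      refine ⟨_, ⟨T + 1, min ε 1, lt_min hε one_pos, rfl⟩, ?_⟩
      rintro ⟨x, y⟩ ⟨lam, h1, h2⟩
      have h1' : ∀ s, dist (lam.symm s) s ≤ min ε 1 := fun s => by
        have := h1 (lam.symm s)
        rwa [lam.apply_symm_apply, dist_comm] at this
      refine ⟨lam.symm, fun s => (h1' s).trans (min_le_left _ _), fun s hs => ?_⟩
      have := h2 (lam.symm s) (le_add_of_dist_le_one ((h1' s).trans (min_le_right _ _)) hs)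
      rw [lam.apply_symm_apply, dist_comm] at this
      exact this.trans (min_le_left _ _))
    (by
      rintro _ ⟨T, ε, hε, rfl⟩
      refine ⟨_, ⟨T + 1, min (ε / 2) 1, lt_min (half_pos hε) one_pos, rfl⟩, ?_⟩
      rintro ⟨x, z⟩ ⟨y, ⟨lam, h1, h2⟩, ⟨mu, h3, h4⟩⟩
      have hle : min (ε / 2) 1 ≤ ε / 2 := min_le_left _ _
      refine ⟨lam.trans mu, fun s => ?_, fun s hs => ?_⟩
      · have := dist_triangle (mu (lam s)) (lam s) s
        have h5 := h1 s
        have h6 := h3 (lam s)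
        simp only [OrderIso.trans_apply]
        linarith
      · have h5 := h2 s (hs.trans (le_add_of_nonneg_right zero_le_one))
        have h6 := h4 (lam s) (le_add_of_dist_le_one ((h1 s).trans (min_le_right _ _)) hs)
        have := dist_triangle (x s) (y (lam s)) (z (mu (lam s)))
        simp only [OrderIso.trans_apply]
        linarith)

/-- The Skorokhod (J₁) topology on the space of càdlàg paths. -/
@[reducible]
def jOneTopology (E : Type*) [NormedAddCommGroup E] : TopologicalSpace (CadlagPath E) :=
  (jOneUniformSpace E).toTopologicalSpace

/-- The local uniform topology: uniform convergence on compact subsets of `[0, ∞)`. -/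
@[reducible]
def locUnifTopology (E : Type*) [NormedAddCommGroup E] : TopologicalSpace (CadlagPath E) :=
  TopologicalSpace.induced
    (fun x : CadlagPath E => UniformOnFun.ofFun {K : Set ℝ≥0 | IsCompact K} x.toFun) inferInstance

end paths

/-! ### Partitions and approximations along partitions -/

/-- A sequence of partitions `0 = t n 0 < t n 1 < ⋯ < t n (k n)` of `[0, ∞)`, with last points
tending to infinity and mesh tending to zero on compacts. The values `t n i` for `i > k n` play
no role. -/
structure PartitionSeq where
  k : ℕ → ℕ
  t : ℕ → ℕ → ℝ≥0
  t_zero : ∀ n, t n 0 = 0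
  t_lt : ∀ n, ∀ i < k n, t n i < t n (i + 1)
  last_tendsto : Tendsto (fun n => t n (k n)) atTop atTop
  mesh : ∀ T : ℝ≥0, ∀ ε > 0, ∀ᶠ n in atTop, ∀ i < k n, t n i ≤ T → t n (i + 1) < t n i + ε

namespace PartitionSeq

variable (π : PartitionSeq)

/-- `t'_n`, the largest point of the `n`-th partition in `[0, t)`, and `0` if there is none. -/
noncomputable def pred (n : ℕ) (t : ℝ≥0) : ℝ≥0 :=
  ((Finset.range (π.k n + 1)).filter fun i => π.t n i < t).sup (π.t n)

section

variable {E : Type*} [NormedAddCommGroup E]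

/-- The piecewise constant approximation `x^n = ∑ x(t_{i+1}) 1_{[t_i, t_{i+1})}`. -/
noncomputable def stepApprox (n : ℕ) (x : CadlagPath E) : CadlagPath E where
  toFun s := ∑ i ∈ Finset.range (π.k n),
    (Ico (π.t n i) (π.t n (i + 1))).indicator (fun _ => x (π.t n (i + 1))) s
  cadlag := isCadlag_sum _ _ fun _ => isCadlag_indicator_Ico _ _ _

/-- The continuous piecewise linear approximation `x^{(n)}`, interpolating `x` at the points of
the `n`-th partition and constant after the last one: the `i`-th coefficient is `0` before `t_i`,
`1` after `t_{i+1}`, and affine in between. -/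
noncomputable def linApprox [NormedSpace ℝ E] (n : ℕ) (x : CadlagPath E) : CadlagPath E where
  toFun s := x 0 + ∑ i ∈ Finset.range (π.k n),
    (((min s (π.t n (i + 1)) : ℝ≥0) - (min s (π.t n i) : ℝ≥0) : ℝ) /
      (π.t n (i + 1) - π.t n i : ℝ)) • (x (π.t n (i + 1)) - x (π.t n i))
  cadlag := isCadlag_of_continuous (by fun_prop)

end

variable {m : ℕ}

/-- The step function
`q_n(t) = ∑_{t_i ≤ t} (x(t_{i+1}) - x(t_i)) (x(t_{i+1}) - x(t_i))'`. -/
noncomputable def qvApprox (n : ℕ) (x : CadlagPath (EuclideanSpace ℝ (Fin m))) :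
    CadlagPath (Matrix (Fin m) (Fin m) ℝ) where
  toFun s := ∑ i ∈ Finset.range (π.k n), (Ici (π.t n i)).indicator
    (fun _ => Matrix.vecMulVec (fun j => x (π.t n (i + 1)) j - x (π.t n i) j)
      (fun j => x (π.t n (i + 1)) j - x (π.t n i) j)) s
  cadlag := isCadlag_sum _ _ fun _ => isCadlag_indicator_Ici _ _

/-- `x` has quadratic variation `Q` along `π`: `q_n → Q` in the Skorokhod topology. -/
def HasQuadVar (x : CadlagPath (EuclideanSpace ℝ (Fin m)))
    (Q : CadlagPath (Matrix (Fin m) (Fin m) ℝ)) : Prop :=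
  Tendsto (fun n => π.qvApprox n x) atTop (@nhds _ (jOneTopology _) Q)

/-! ### Generic sets of paths -/

/-- Generic sets of paths: non-empty, stable under piecewise constant approximation along `π` and
under vertical perturbation. -/
structure IsGeneric (Ω : Set (CadlagPath (EuclideanSpace ℝ (Fin m)))) : Prop where
  nonempty : Ω.Nonempty
  step_mem : ∀ x ∈ Ω, ∀ T > 0, ∃ N, ∀ n ≥ N, (π.stepApprox n x).stopAt T ∈ Ω
  perturb_mem : ∀ x ∈ Ω, ∀ t, ∃ U : Set (EuclideanSpace ℝ (Fin m)),
    Convex ℝ U ∧ U ∈ 𝓝 0 ∧ -x.jump t ∈ U ∧ ∀ e ∈ U, x.perturb t e ∈ Ω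

/-- `Ω` is generic and contains a path whose quadratic variation along `π` is continuous and
strictly increasing (for the Loewner order: the increments are positive semidefinite and
non-zero), as well as the piecewise linear approximations of this path for large `n`. -/
def IsRich (Ω : Set (CadlagPath (EuclideanSpace ℝ (Fin m)))) : Prop :=
  π.IsGeneric Ω ∧ ∃ x ∈ Ω, ∃ Q : CadlagPath (Matrix (Fin m) (Fin m) ℝ), π.HasQuadVar x Q ∧
    Continuous Q.toFun ∧ (∀ s t, s < t → (Q t - Q s).PosSemidef ∧ Q s ≠ Q t) ∧
    ∃ N, ∀ n ≥ N, π.linApprox n x ∈ Ω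

end PartitionSeq

/-! ### The space of stopped paths and its topologies -/

section domain

variable {m : ℕ}

/-- `Λ = {(t, x_t) | t ≥ 0, x ∈ Ω}`. -/
def domain (Ω : Set (CadlagPath (EuclideanSpace ℝ (Fin m)))) :
    Set (ℝ≥0 × CadlagPath (EuclideanSpace ℝ (Fin m))) :=
  {z | ∃ t, ∃ x ∈ Ω, z = (t, x.stopAt t)}

/-- The value of a functional `F : Λ → ℝ` at `(t, y)`, with the placeholder `0` outside `Λ`. The
lemmas below show that for generic `Ω` the placeholder never matters where this is used. -/
noncomputable def evalAt {Ω : Set (CadlagPath (EuclideanSpace ℝ (Fin m)))} (F : domain Ω → ℝ)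
    (t : ℝ≥0) (y : CadlagPath (EuclideanSpace ℝ (Fin m))) : ℝ :=
  open Classical in if h : (t, y) ∈ domain Ω then F ⟨(t, y), h⟩ else 0

/-- The set `𝔛` of functionals on `Λ` that generates the `π`-topology. -/
structure IsPiRegular (π : PartitionSeq) {Ω : Set (CadlagPath (EuclideanSpace ℝ (Fin m)))}
    (F : domain Ω → ℝ) : Prop where
  left_a : ∀ x ∈ Ω, ∀ t,
    Tendsto (fun s => evalAt F s (x.stopBefore s)) (𝓝[≤] t) (𝓝 (evalAt F t (x.stopBefore t)))
  left_b : ∀ x ∈ Ω, ∀ t,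
    Tendsto (fun s => evalAt F s (x.stopAt s)) (𝓝[<] t) (𝓝 (evalAt F t (x.stopBefore t)))
  left_c : ∀ x ∈ Ω, ∀ t, ∀ u : ℕ → ℝ≥0, Tendsto u atTop (𝓝 t) →
    (∀ᶠ n in atTop, u n ≤ π.pred n t) →
    Tendsto (fun n => evalAt F (u n) ((π.stepApprox n x).stopBefore (u n))) atTop
      (𝓝 (evalAt F t (x.stopBefore t)))
  left_d : ∀ x ∈ Ω, ∀ t, ∀ u : ℕ → ℝ≥0, Tendsto u atTop (𝓝 t) →
    (∀ᶠ n in atTop, u n < π.pred n t) →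
    Tendsto (fun n => evalAt F (u n) ((π.stepApprox n x).stopAt (u n))) atTop
      (𝓝 (evalAt F t (x.stopBefore t)))
  right_a : ∀ x ∈ Ω, ∀ t,
    Tendsto (fun s => evalAt F s (x.stopAt s)) (𝓝[≥] t) (𝓝 (evalAt F t (x.stopAt t)))
  right_b : ∀ x ∈ Ω, ∀ t,
    Tendsto (fun s => evalAt F s (x.stopBefore s)) (𝓝[>] t) (𝓝 (evalAt F t (x.stopAt t)))
  right_c : ∀ x ∈ Ω, ∀ t, ∀ u : ℕ → ℝ≥0, Tendsto u atTop (𝓝 t) →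
    (∀ᶠ n in atTop, π.pred n t ≤ u n) →
    Tendsto (fun n => evalAt F (u n) ((π.stepApprox n x).stopAt (u n))) atTop
      (𝓝 (evalAt F t (x.stopAt t)))
  right_d : ∀ x ∈ Ω, ∀ t, ∀ u : ℕ → ℝ≥0, Tendsto u atTop (𝓝 t) →
    (∀ᶠ n in atTop, π.pred n t < u n) →
    Tendsto (fun n => evalAt F (u n) ((π.stepApprox n x).stopBefore (u n))) atTop
      (𝓝 (evalAt F t (x.stopAt t)))

/-- The `π`-topology on `Λ`: the initial topology generated by `𝔛`. -/
@[reducible]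
noncomputable def piTopology (π : PartitionSeq) (Ω : Set (CadlagPath (EuclideanSpace ℝ (Fin m)))) :
    TopologicalSpace (domain Ω) :=
  ⨅ F : {F : domain Ω → ℝ // IsPiRegular π F}, TopologicalSpace.induced F.1 inferInstance

/-- The topology induced on `Λ` by the product of the usual topology on `[0, ∞)` with a topology
`τ` on paths. -/
@[reducible]
noncomputable def prodTopologyOn (τ : TopologicalSpace (CadlagPath (EuclideanSpace ℝ (Fin m))))
    (Ω : Set (CadlagPath (EuclideanSpace ℝ (Fin m)))) : TopologicalSpace (domain Ω) :=
  TopologicalSpace.induced Subtype.val (@instTopologicalSpaceProd _ _ inferInstance τ)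

/-- The J₁ topology on `Λ`. -/
@[reducible]
noncomputable def jOneTopologyOn (Ω : Set (CadlagPath (EuclideanSpace ℝ (Fin m)))) : TopologicalSpace (domain Ω) :=
  prodTopologyOn (jOneTopology _) Ω

/-- The uniform (U) topology on `Λ`. -/
@[reducible]
noncomputable def unifTopologyOn (Ω : Set (CadlagPath (EuclideanSpace ℝ (Fin m)))) : TopologicalSpace (domain Ω) :=
  prodTopologyOn (locUnifTopology _) Ω

/-! All the points at which `IsPiRegular` evaluates a functional lie (eventually) in `Λ`. -/

variable {π : PartitionSeq} {Ω : Set (CadlagPath (EuclideanSpace ℝ (Fin m)))}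

theorem mem_domain_stopAt {x : CadlagPath (EuclideanSpace ℝ (Fin m))} (hx : x ∈ Ω) (t : ℝ≥0) :
    (t, x.stopAt t) ∈ domain Ω := ⟨t, x, hx, rfl⟩

theorem mem_domain_stopBefore (hΩ : π.IsGeneric Ω) {x : CadlagPath (EuclideanSpace ℝ (Fin m))}
    (hx : x ∈ Ω) (t : ℝ≥0) : (t, x.stopBefore t) ∈ domain Ω := by
  obtain ⟨U, -, -, h1, h2⟩ := hΩ.perturb_mem x hx t
  refine ⟨t, _, h2 _ h1, ?_⟩
  congr 1
  ext1
  funext s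
  by_cases hs : s < t
  · simp [CadlagPath.stopBefore, CadlagPath.stopAt, CadlagPath.perturb, hs, hs.le]
  · simp [CadlagPath.stopBefore, CadlagPath.stopAt, CadlagPath.perturb, CadlagPath.jump, hs, not_lt.1 hs]

theorem stopAt_stopAt (x : CadlagPath (EuclideanSpace ℝ (Fin m))) {s t : ℝ≥0} (h : s ≤ t) :
    (x.stopAt t).stopAt s = x.stopAt s := by
  ext1
  funext u
  simp [CadlagPath.stopAt, h]

theorem stopBefore_stopAt (x : CadlagPath (EuclideanSpace ℝ (Fin m))) {s t : ℝ≥0} (h : s ≤ t) :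
    (x.stopAt t).stopBefore s = x.stopBefore s := by
  have hl : (x.stopAt t).left s = x.left s := by
    unfold CadlagPath.left
    rcases eq_or_ne (𝓝[<] s) ⊥ with hb | hb
    · rw [leftLim_eq_of_eq_bot _ hb, leftLim_eq_of_eq_bot _ hb]
      simp [CadlagPath.stopAt, h]
    · obtain ⟨l, hl⟩ := (x.cadlag s).2
      have : (𝓝[<] s).NeBot := ⟨hb⟩
      rw [leftLim_eq_of_tendsto hl]
      refine leftLim_eq_of_tendsto (hl.congr' ?_)
      filter_upwards [self_mem_nhdsWithin] with u hu
      simp [CadlagPath.stopAt, (le_of_lt hu).trans h]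
  ext1
  funext u
  by_cases hu : u < s
  · simp [CadlagPath.stopBefore, hu, CadlagPath.stopAt, hu.le.trans h]
  · simp [CadlagPath.stopBefore, hu, hl]

theorem eventually_mem_domain (hΩ : π.IsGeneric Ω) {x : CadlagPath (EuclideanSpace ℝ (Fin m))}
    (hx : x ∈ Ω) {t : ℝ≥0} {u : ℕ → ℝ≥0} (hu : Tendsto u atTop (𝓝 t)) :
    ∀ᶠ n in atTop, (u n, (π.stepApprox n x).stopAt (u n)) ∈ domain Ω ∧
      (u n, (π.stepApprox n x).stopBefore (u n)) ∈ domain Ω := by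
  have hT : t < t + 1 := lt_add_of_pos_right _ one_pos
  obtain ⟨N, hN⟩ := hΩ.step_mem x hx (t + 1) (pos_of_gt hT)
  filter_upwards [eventually_ge_atTop N, hu.eventually (Iio_mem_nhds hT)] with n hn hun
  refine ⟨?_, ?_⟩
  · rw [← stopAt_stopAt _ (le_of_lt hun)]
    exact mem_domain_stopAt (hN n hn) _
  · rw [← stopBefore_stopAt _ (le_of_lt hun)]
    exact mem_domain_stopBefore hΩ (hN n hn) _

end domain

end CausalCalculus

/-!
A `J₁`-continuous functional is in `𝔛` because each of the paths in the definition of `𝔛` converges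
to `x_{t-}` or `x_t` in `J₁`: the comparison `t'_n` versus `u_n` decides whether `x^n`, stopped at
`u_n`, has already made the jump of `x` at `t`. As the `J₁` topology is completely regular, it is
determined by its continuous functionals, hence is coarser than the `π`-topology.

If `y` jumps at `t`, the paths `(y^n)_t` `π`-converge to `y_t` but not uniformly, since `y^n` makes
the jump already at `t'_n < t`. So the `π`-topology is not finer than `U`.

For the converse, the quadratic variation of a locally Lipschitz path vanishes near `0`, so the
given path `x` is continuous but not locally Lipschitz, and the interpolations `x^{(n)}` converge to
`x` uniformly on compacts. Until some time `T` they differ from `x` and from each step function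
`x^k`, `k` large. A Urysohn function `M` on the metrizable space of the restrictions of paths to a
countable dense set then vanishes on `x` and the `x^k`, equals `1` on the `x^{(n)}`, and is
continuous except at `x`. The functional `(t, y) ↦ (t - T)⁺ M(y)` is in `𝔛`, which only tests
convergence along step approximations, but it is not `U`-continuous.
-/

namespace CausalCalculus

section timeChange

theorem exists_orderIso_add {g : ℝ≥0 → ℝ} {K : ℝ≥0} (hK : K < 1) (hg : LipschitzWith K g)
    (h0 : g 0 = 0) : ∃ lam : ℝ≥0 ≃o ℝ≥0, ∀ s, (lam s : ℝ) = s + g s := by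
  have hmono : StrictMono fun s : ℝ≥0 => (s : ℝ) + g s := by
    intro s t hst
    have hle := (abs_le.1 (hg.dist_le_mul s t)).2
    rw [dist_comm, NNReal.dist_eq, abs_of_pos (sub_pos.2 (NNReal.coe_lt_coe.2 hst))] at hle
    have hlt := mul_lt_of_lt_one_left (sub_pos.2 (NNReal.coe_lt_coe.2 hst)) (NNReal.coe_lt_one.2 hK)
    change (s : ℝ) + g s < t + g t
    linarith
  have hnonneg (s : ℝ≥0) : 0 ≤ (s : ℝ) + g s := by
    simpa [h0] using hmono.monotone (zero_le : 0 ≤ s)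
  let f (s : ℝ≥0) : ℝ≥0 := ⟨s + g s, hnonneg s⟩
  have hcont : Continuous f := by
    have := hg.continuous
    fun_prop
  have hsurj : Function.Surjective f := by
    intro y
    refine mem_range_of_exists_le_of_exists_ge hcont ⟨0, ?_⟩ ⟨y / (1 - K), ?_⟩
    · change ((0 : ℝ≥0) : ℝ) + g 0 ≤ y
      simp [h0]
    · set u := y / (1 - K)
      have hu : (u : ℝ) - K * u = y := by
        have : (1 : ℝ) - K ≠ 0 := (sub_pos.2 (NNReal.coe_lt_one.2 hK)).ne'
        rw [NNReal.coe_div, NNReal.coe_sub hK.le, NNReal.coe_one]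
        field_simp
      have hge := (abs_le.1 (hg.dist_le_mul u 0)).1
      rw [h0, NNReal.dist_eq, NNReal.coe_zero, sub_zero, sub_zero, NNReal.abs_eq] at hge
      change (y : ℝ) ≤ u + g u
      linarith
  exact ⟨StrictMono.orderIsoOfSurjective f (fun s t hst => hmono hst) hsurj, fun s => rfl⟩

/- The displacements `ρ i r - r` of the points of `insert 0 S` are eventually `1 / 2`-Lipschitz in
`r`, so that McShane's extension turns them into a small perturbation of the identity. -/
theorem eventually_exists_orderIso_eqOn {ι : Type*} {l : Filter ι} {ρ : ι → ℝ≥0 → ℝ≥0}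
    (hρ0 : ∀ i, ρ i 0 = 0) (S : Finset ℝ≥0) (hρ : ∀ r ∈ S, Tendsto (ρ · r) l (𝓝 r)) {ε : ℝ}
    (hε : 0 < ε) :
    ∀ᶠ i in l, ∃ lam : ℝ≥0 ≃o ℝ≥0, (∀ s, dist (lam s) s ≤ ε) ∧ EqOn lam (ρ i) S := by
  classical
  let g (i : ι) (r : ℝ≥0) : ℝ := ρ i r - r
  have hg : ∀ r ∈ insert 0 S, Tendsto (g · r) l (𝓝 0) := by
    intro r hr
    rcases Finset.mem_insert.1 hr with rfl | hr
    · simp [g, hρ0, tendsto_const_nhds]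
    · simpa [g] using ((NNReal.tendsto_coe.2 (hρ r hr)).sub_const (r : ℝ))
  have hsmall : ∀ᶠ i in l, ∀ r ∈ insert 0 S, |g i r| < ε := by
    refine (Finset.eventually_all _).2 fun r hr => (hg r hr).abs.eventually_lt_const ?_
    simpa using hε
  have hlip : ∀ᶠ i in l, ∀ r ∈ insert 0 S, ∀ r' ∈ insert 0 S,
      dist (g i r) (g i r') ≤ (1 / 2 : ℝ≥0) * dist r r' := by
    refine (Finset.eventually_all _).2 fun r hr => (Finset.eventually_all _).2 fun r' hr' => ?_
    rcases eq_or_ne r r' with rfl | hne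
    · simp
    · refine ((hg r hr).dist (hg r' hr')).eventually_le_const ?_
      simpa using hne
  filter_upwards [hsmall, hlip] with i hsmall hlip
  obtain ⟨h, hh, hgh⟩ := (LipschitzOnWith.of_dist_le_mul hlip).extend_real
  have hclamp : ∀ r ∈ insert 0 S, max (-ε) (min ε (h r)) = g i r := by
    intro r hr
    have := abs_lt.1 (hsmall r hr)
    rw [← hgh hr, min_eq_right this.2.le, max_eq_right this.1.le]
  obtain ⟨lam, hlam⟩ := exists_orderIso_add (K := 1 / 2) (by norm_num)
    ((hh.const_min ε).const_max (-ε))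
    ((hclamp 0 (Finset.mem_insert_self 0 S)).trans (by simp [g, hρ0]))
  refine ⟨lam, fun s => ?_, fun r hr => NNReal.eq ?_⟩
  · rw [NNReal.dist_eq, hlam, add_sub_cancel_left]
    exact abs_le.2 ⟨le_max_left _ _, max_le (by linarith) (min_le_left _ _)⟩
  · rw [hlam, hclamp r (Finset.mem_insert_of_mem hr), add_sub_cancel]

end timeChange

section topologies

theorem le_of_forall_continuous_real {X : Type*} {σ τ : TopologicalSpace X}
    (hτ : @CompletelyRegularSpace X τ)
    (h : ∀ F : X → ℝ, Continuous[τ, inferInstance] F → Continuous[σ, inferInstance] F) :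
    σ ≤ τ := by
  refine le_of_nhds_le_nhds fun x U hU => ?_
  obtain ⟨V, hVU, hV, hxV⟩ := (@mem_nhds_iff _ τ _ _).1 hU
  obtain ⟨f, hf, hfx, hfV⟩ :=
    @CompletelyRegularSpace.completely_regular_isOpen X τ hτ x V hV hxV
  have hcont := h _ (@Continuous.comp _ _ _ τ _ _ _ _ continuous_subtype_val hf)
  have hlt : ∀ᶠ y in @nhds _ σ x, (f y : ℝ) < 1 :=
    (@Continuous.tendsto _ _ σ _ _ hcont x).eventually_lt_const (by simp [hfx])
  filter_upwards [hlt] with y hy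
  by_contra hyU
  simp [hfV fun hyV => hyU (hVU hyV)] at hy

variable {E : Type*} [NormedAddCommGroup E] {ι : Type*} {l : Filter ι}
  {f g : ι → CadlagPath E} {z : CadlagPath E}

theorem tendsto_jOneTopology_iff : Tendsto f l (@nhds _ (jOneTopology E) z) ↔
    ∀ T : ℝ≥0, ∀ ε > 0, ∀ᶠ i in l, (z, f i) ∈ jOneEntourage T ε := by
  have hbasis : (@uniformity _ (jOneUniformSpace E)).HasBasis
      (fun V => ∃ T : ℝ≥0, ∃ ε : ℝ, 0 < ε ∧ V = jOneEntourage T ε) id := FilterBasis.hasBasis _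
  rw [(@nhds_basis_uniformity' _ _ (jOneUniformSpace E) _ _ hbasis z).tendsto_right_iff]
  exact ⟨fun h T ε hε => h _ ⟨T, ε, hε, rfl⟩, by rintro h _ ⟨T, ε, hε, rfl⟩; exact h T ε hε⟩

theorem tendsto_locUnifTopology_iff : Tendsto f l (@nhds _ (locUnifTopology E) z) ↔
    ∀ T : ℝ≥0, ∀ ε > 0, ∀ᶠ i in l, ∀ s ≤ T, dist (z s) (f i s) < ε := by
  rw [nhds_induced, tendsto_comap_iff, UniformOnFun.tendsto_iff_tendstoUniformlyOn]
  simp only [Metric.tendstoUniformlyOn_iff]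
  constructor
  · intro h T ε hε
    filter_upwards [h (Icc 0 T) isCompact_Icc ε hε] with i hi s hs using hi s ⟨zero_le, hs⟩
  · intro h K hK ε hε
    obtain ⟨T, hT⟩ := IsCompact.bddAbove hK
    filter_upwards [h T ε hε] with i hi s hs using hi s (hT hs)

theorem tendsto_jOneTopology_of_dist_le (hf : Tendsto f l (@nhds _ (jOneTopology E) z))
    (hfg : ∀ T : ℝ≥0, ∀ ε > 0, ∀ᶠ i in l, ∀ s ≤ T, dist (f i s) (g i s) ≤ ε) :
    Tendsto g l (@nhds _ (jOneTopology E) z) := by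
  refine @Filter.Tendsto.congr_uniformity _ _ (jOneUniformSpace E) _ _ _ _ hf ?_
  refine (FilterBasis.hasBasis _).tendsto_right_iff.2 ?_
  rintro _ ⟨T, ε, hε, rfl⟩
  filter_upwards [hfg T ε hε] with i hi
  exact ⟨OrderIso.refl _, fun s => by simpa using hε.le, hi⟩

theorem locUnifTopology_le_jOneTopology : locUnifTopology E ≤ jOneTopology E := by
  refine le_of_nhds_le_nhds fun z => tendsto_jOneTopology_of_dist_le
    (f := fun _ => z) (@tendsto_const_nhds _ (jOneTopology E) _ _ _) fun T ε hε => ?_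
  filter_upwards [tendsto_locUnifTopology_iff.1 tendsto_id T ε hε] with y hy s hs
  exact (hy s hs).le

theorem completelyRegularSpace_jOneTopology : @CompletelyRegularSpace _ (jOneTopology E) :=
  @UniformSpace.toCompletelyRegularSpace _ (jOneUniformSpace E)

theorem completelyRegularSpace_locUnifTopology : @CompletelyRegularSpace _ (locUnifTopology E) :=
  completelyRegularSpace_induced inferInstance _

end topologies

namespace CadlagPath

variable {E : Type*} [NormedAddCommGroup E] (x : CadlagPath E)

theorem tendsto_left (t : ℝ≥0) : Tendsto x (𝓝[<] t) (𝓝 (x.left t)) :=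
  tendsto_leftLim_of_tendsto (x.cadlag t).2

theorem left_zero : x.left 0 = x 0 := leftLim_eq_of_isBot isBot_bot

theorem dist_left_le {a t : ℝ≥0} (hat : a < t) {c : E} {ε : ℝ}
    (h : ∀ s ∈ Ico a t, dist (x s) c ≤ ε) : dist (x.left t) c ≤ ε := by
  have := nhdsLT_neBot_of_exists_lt ⟨a, hat⟩
  refine le_of_tendsto ((x.tendsto_left t).dist tendsto_const_nhds) ?_
  filter_upwards [Ico_mem_nhdsLT hat] with s hs using h s hs

theorem exists_dist_left_le {t : ℝ≥0} (ht : 0 < t) {ε : ℝ} (hε : 0 < ε) :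
    ∃ a < t, ∀ s ∈ Ico a t, dist (x s) (x.left t) ≤ ε := by
  have h := (x.tendsto_left t).eventually (Metric.closedBall_mem_nhds (x.left t) hε)
  obtain ⟨a, hat, ha⟩ := (mem_nhdsLT_iff_exists_Ioo_subset' ht).1 h
  obtain ⟨b, hab, hbt⟩ := exists_between (mem_Iio.1 hat)
  exact ⟨b, hbt, fun s hs => ha ⟨hab.trans_le hs.1, hs.2⟩⟩

theorem exists_dist_right_le (t : ℝ≥0) {ε : ℝ} (hε : 0 < ε) :
    ∃ b > t, ∀ s ∈ Ico t b, dist (x s) (x t) ≤ ε := by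
  have h := (x.cadlag t).1.eventually (Metric.closedBall_mem_nhds (x t) hε)
  exact (mem_nhdsGE_iff_exists_Ico_subset' (lt_add_one t)).1 h

theorem tendsto_left_nhdsLT (t : ℝ≥0) : Tendsto x.left (𝓝[<] t) (𝓝 (x.left t)) := by
  rcases eq_zero_or_pos t with rfl | ht
  · simp
  refine Metric.nhds_basis_closedBall.tendsto_right_iff.2 fun ε hε => ?_
  obtain ⟨a, hat, ha⟩ := x.exists_dist_left_le ht hε
  filter_upwards [Ioo_mem_nhdsLT hat] with s hs
  exact x.dist_left_le hs.1 fun r hr => ha r ⟨hr.1, hr.2.trans hs.2⟩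

theorem tendsto_left_nhdsGT (t : ℝ≥0) : Tendsto x.left (𝓝[>] t) (𝓝 (x t)) := by
  refine Metric.nhds_basis_closedBall.tendsto_right_iff.2 fun ε hε => ?_
  obtain ⟨b, htb, hb⟩ := x.exists_dist_right_le t hε
  filter_upwards [Ioo_mem_nhdsGT htb] with s hs
  exact x.dist_left_le hs.1 fun r hr => hb r ⟨hr.1, hr.2.trans hs.2⟩

theorem dist_le_of_mem_Ico {a b u v : ℝ≥0} {c : E} {ε : ℝ}
    (h : ∀ s ∈ Ico a b, dist (x s) c ≤ ε / 2) (hu : u ∈ Ico a b) (hv : v ∈ Ico a b) :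
    dist (x u) (x v) ≤ ε :=
  (dist_triangle_right _ _ c).trans (by linarith [h u hu, h v hv])

theorem exists_finset_dist_le_nhds (t : ℝ≥0) {ε : ℝ} (hε : 0 < ε) :
    ∃ A ∈ 𝓝 t, ∃ S : Finset ℝ≥0, ∀ u ∈ A, ∀ v, (∀ r ∈ S, r ≤ u ↔ r ≤ v) →
      dist (x u) (x v) ≤ ε := by
  obtain ⟨b, htb, hb⟩ := x.exists_dist_right_le t (half_pos hε)
  rcases eq_zero_or_pos t with rfl | ht
  · refine ⟨Iio b, Iio_mem_nhds htb, {b}, fun u hu v huv => ?_⟩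
    have hvb : v < b := not_le.1 fun h => hu.not_ge ((huv b (by simp)).2 h)
    exact x.dist_le_of_mem_Ico hb ⟨zero_le, hu⟩ ⟨zero_le, hvb⟩
  · obtain ⟨a, hat, ha⟩ := x.exists_dist_left_le ht (half_pos hε)
    refine ⟨Ioo a b, Ioo_mem_nhds hat htb, {a, t, b}, fun u hu v huv => ?_⟩
    have hav : a ≤ v := (huv a (by simp)).1 hu.1.le
    have htuv : t ≤ u ↔ t ≤ v := huv t (by simp)
    have hvb : v < b := not_le.1 fun h => hu.2.not_ge ((huv b (by simp)).2 h)
    rcases le_or_gt t u with htu | hut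
    · exact x.dist_le_of_mem_Ico hb ⟨htu, hu.2⟩ ⟨htuv.1 htu, hvb⟩
    · have hvt : v < t := not_le.1 fun h => hut.not_ge (htuv.2 h)
      exact x.dist_le_of_mem_Ico ha ⟨hu.1.le, hut⟩ ⟨hav, hvt⟩

theorem exists_finset_dist_le (T : ℝ≥0) {ε : ℝ} (hε : 0 < ε) :
    ∃ S : Finset ℝ≥0, ∀ u ≤ T, ∀ v, (∀ r ∈ S, r ≤ u ↔ r ≤ v) → dist (x u) (x v) ≤ ε := by
  classical
  choose A hA S hS using fun t => x.exists_finset_dist_le_nhds t hε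
  obtain ⟨I, -, hI⟩ := (isCompact_Icc (a := 0) (b := T)).elim_nhds_subcover A fun t _ => hA t
  refine ⟨I.biUnion S, fun u hu v huv => ?_⟩
  obtain ⟨t, ht, hut⟩ := mem_iUnion₂.1 (hI ⟨zero_le, hu⟩)
  exact hS t u hut v fun r hr => huv r (Finset.mem_biUnion.2 ⟨t, ht, hr⟩)

/-- The path that follows `x` before time `t` and is equal to `c` from then on. The choices
`c = x(t)` and `c = x(t-)` give `x_t` and `x_{t-}`. -/
noncomputable def freezeAt (t : ℝ≥0) (c : E) : CadlagPath E where
  toFun s := if s < t then x s else c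
  cadlag := isCadlag_glue x.cadlag (isCadlag_const c) t

variable {x} in
theorem freezeAt_of_lt {s t : ℝ≥0} (h : s < t) (c : E) : x.freezeAt t c s = x s := if_pos h

variable {x} in
theorem freezeAt_of_le {s t : ℝ≥0} (h : t ≤ s) (c : E) : x.freezeAt t c s = c := if_neg h.not_gt

theorem stopBefore_eq_freezeAt (t : ℝ≥0) : x.stopBefore t = x.freezeAt t (x.left t) := rfl

theorem stopAt_eq_freezeAt (t : ℝ≥0) : x.stopAt t = x.freezeAt t (x t) := by
  ext s
  rcases lt_or_ge s t with h | h
  · simp [freezeAt, stopAt, h, h.le]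
  · simp [freezeAt, stopAt, h, h.not_gt]

theorem stopBefore_eq_stopAt {t : ℝ≥0} (h : x.left t = x t) : x.stopBefore t = x.stopAt t := by
  rw [stopBefore_eq_freezeAt, stopAt_eq_freezeAt, h]

variable {x}

theorem stopAt_apply_of_le {s t : ℝ≥0} (h : s ≤ t) : x.stopAt t s = x s := by
  simp [stopAt, h]

theorem dist_freezeAt_le {s t : ℝ≥0} (hst : s ≤ t) {c d : E} {ε : ℝ} (hε : 0 ≤ ε)
    (hc : ∀ v ∈ Ico s t, dist (x v) c ≤ ε) (hcd : dist c d ≤ ε) (v : ℝ≥0) :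
    dist (x.freezeAt s c v) (x.freezeAt t d v) ≤ ε := by
  rcases lt_or_ge v s with hvs | hsv
  · rwa [freezeAt_of_lt hvs, freezeAt_of_lt (hvs.trans_le hst), dist_self]
  rw [freezeAt_of_le hsv]
  rcases lt_or_ge v t with hvt | htv
  · rw [freezeAt_of_lt hvt, dist_comm]
    exact hc v ⟨hsv, hvt⟩
  · rwa [freezeAt_of_le htv]

theorem tendsto_freezeAt_iff {ι : Type*} {l : Filter ι} {y : ι → CadlagPath E} {s t : ι → ℝ≥0}
    {c d : ι → E} {e : E} {z : CadlagPath E} (hst : ∀ᶠ i in l, s i ≤ t i)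
    (hc : Tendsto c l (𝓝 e)) (hd : Tendsto d l (𝓝 e))
    (hy : ∀ ε > 0, ∀ᶠ i in l, ∀ v ∈ Ico (s i) (t i), dist (y i v) e ≤ ε) :
    Tendsto (fun i => (y i).freezeAt (s i) (c i)) l (@nhds _ (jOneTopology E) z) ↔
      Tendsto (fun i => (y i).freezeAt (t i) (d i)) l (@nhds _ (jOneTopology E) z) := by
  have hclose : ∀ ε > 0, ∀ᶠ i in l, ∀ v,
      dist ((y i).freezeAt (s i) (c i) v) ((y i).freezeAt (t i) (d i) v) ≤ ε := by
    intro ε hε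
    filter_upwards [hst, hy _ (half_pos hε), hc.eventually (Metric.ball_mem_nhds e (half_pos hε)),
      hd.eventually (Metric.ball_mem_nhds e (half_pos hε))] with i hst hy hc hd
    refine dist_freezeAt_le hst hε.le (fun v hv => ?_) ?_
    · linarith [hy v hv, Metric.mem_ball.1 hc, dist_triangle_right (y i v) (c i) e]
    · linarith [Metric.mem_ball.1 hc, Metric.mem_ball.1 hd, dist_triangle_right (c i) (d i) e]
  constructor <;> refine fun h => tendsto_jOneTopology_of_dist_le h fun T ε hε => ?_
  · exact (hclose ε hε).mono fun i hi v _ => hi v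
  · exact (hclose ε hε).mono fun i hi v _ => dist_comm _ _ |>.trans_le (hi v)

variable {ι : Type*} {l : Filter ι} {s : ι → ℝ≥0} {t : ℝ≥0} {c : ι → E}

theorem tendsto_freezeAt_left (hs : Tendsto s l (𝓝[<] t)) (hc : Tendsto c l (𝓝 (x.left t))) :
    Tendsto (fun i => x.freezeAt (s i) (c i)) l (@nhds _ (jOneTopology E) (x.stopBefore t)) := by
  obtain ⟨hs, hst⟩ := tendsto_nhdsWithin_iff.1 hs
  refine (tendsto_freezeAt_iff (hst.mono fun _ h => le_of_lt h) hc tendsto_const_nhds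
    fun ε hε => ?_).2 (@tendsto_const_nhds _ (jOneTopology E) _ _ _)
  rcases eq_zero_or_pos t with rfl | ht
  · exact hst.mono fun i hi => (not_lt_zero (mem_Iio.1 hi)).elim
  obtain ⟨a, hat, ha⟩ := x.exists_dist_left_le ht hε
  filter_upwards [hs.eventually (Ioi_mem_nhds hat)] with i hi v hv
  exact ha v ⟨(le_of_lt hi).trans hv.1, hv.2⟩

theorem tendsto_freezeAt_right (hs : Tendsto s l (𝓝[>] t)) (hc : Tendsto c l (𝓝 (x t))) :
    Tendsto (fun i => x.freezeAt (s i) (c i)) l (@nhds _ (jOneTopology E) (x.stopAt t)) := by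
  obtain ⟨hs, hst⟩ := tendsto_nhdsWithin_iff.1 hs
  rw [stopAt_eq_freezeAt]
  refine (tendsto_freezeAt_iff (hst.mono fun _ h => le_of_lt h) tendsto_const_nhds hc
    fun ε hε => ?_).1 (@tendsto_const_nhds _ (jOneTopology E) _ _ _)
  obtain ⟨b, htb, hb⟩ := x.exists_dist_right_le t hε
  filter_upwards [hs.eventually (Iio_mem_nhds htb)] with i hi v hv
  exact hb v ⟨hv.1, hv.2.trans hi⟩

end CadlagPath

namespace PartitionSeq

variable (π : PartitionSeq) {n : ℕ}

theorem t_le_t {i j : ℕ} (hij : i ≤ j) (hj : j ≤ π.k n) : π.t n i ≤ π.t n j := by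
  induction j, hij using Nat.le_induction with
  | base => exact le_rfl
  | succ j _ ih => exact (ih (by lia)).trans (π.t_lt n j hj).le

theorem lt_of_t_lt_t {i j : ℕ} (hi : i ≤ π.k n) (h : π.t n i < π.t n j) : i < j := by
  by_contra! hij
  exact h.not_ge (π.t_le_t hij hi)

theorem exists_mem_Ico {s : ℝ≥0} (hs : s < π.t n (π.k n)) :
    ∃ i < π.k n, s ∈ Ico (π.t n i) (π.t n (i + 1)) := by
  have hex : ∃ j, s < π.t n j := ⟨_, hs⟩
  classical
  obtain ⟨i, hi⟩ : ∃ i, Nat.find hex = i + 1 :=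
    Nat.exists_eq_succ_of_ne_zero fun h => by simpa [h, π.t_zero] using Nat.find_spec hex
  exact ⟨i, hi.symm.trans_le (Nat.find_min' hex hs), not_lt.1 (Nat.find_min hex (by lia)),
    hi ▸ Nat.find_spec hex⟩

/-- The first point after `s` of the `n`-th partition, if `s` lies before the last point. -/
noncomputable def next (n : ℕ) (s : ℝ≥0) : ℝ≥0 := π.t n (sInf {i | s < π.t n i})

theorem next_eq {i : ℕ} (hi : i < π.k n) {s : ℝ≥0} (hs : s ∈ Ico (π.t n i) (π.t n (i + 1))) :
    π.next n s = π.t n (i + 1) := by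
  have hleast : IsLeast {i | s < π.t n i} (i + 1) :=
    ⟨hs.2, fun j hj => π.lt_of_t_lt_t hi.le (hs.1.trans_lt hj)⟩
  rw [next, hleast.csInf_eq]

theorem lt_next {s : ℝ≥0} (hs : s < π.t n (π.k n)) : s < π.next n s := by
  obtain ⟨i, hi, hsi⟩ := π.exists_mem_Ico hs
  exact π.next_eq hi hsi ▸ hsi.2

theorem pred_le_iff {r s : ℝ≥0} (hs : s < π.t n (π.k n)) : π.pred n r ≤ s ↔ r ≤ π.next n s := by
  obtain ⟨i, hi, hsi⟩ := π.exists_mem_Ico hs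
  rw [π.next_eq hi hsi, pred, Finset.sup_le_iff]
  simp only [Finset.mem_filter, Finset.mem_range, Nat.lt_succ_iff, and_imp]
  constructor
  · intro h
    by_contra! hr
    exact (h (i + 1) hi hr).not_gt hsi.2
  · intro hr j hj hjr
    have hji : j < i + 1 := π.lt_of_t_lt_t hj (hjr.trans_le hr)
    exact (π.t_le_t (Nat.lt_succ_iff.1 hji) hi.le).trans hsi.1

theorem lt_pred_iff {r s : ℝ≥0} (hs : s < π.t n (π.k n)) : s < π.pred n r ↔ π.next n s < r := by
  rw [← not_le, ← not_le, π.pred_le_iff hs]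

theorem pred_le (n : ℕ) (r : ℝ≥0) : π.pred n r ≤ r :=
  Finset.sup_le fun _ hi => (Finset.mem_filter.1 hi).2.le

theorem pred_lt (n : ℕ) {r : ℝ≥0} (hr : 0 < r) : π.pred n r < r :=
  (Finset.sup_lt_iff hr).2 fun _ hi => (Finset.mem_filter.1 hi).2

theorem pred_zero (n : ℕ) : π.pred n 0 = 0 := le_antisymm (π.pred_le n 0) zero_le

theorem exists_pred_eq {r : ℝ≥0} (hr : 0 < r) (hrn : r ≤ π.t n (π.k n)) :
    ∃ i < π.k n, π.pred n r = π.t n i ∧ r ∈ Ioc (π.t n i) (π.t n (i + 1)) := by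
  have hlast := (π.pred_lt n hr).trans_le hrn
  obtain ⟨i, hi, hpi⟩ := π.exists_mem_Ico hlast
  have hir : π.t n i < r := hpi.1.trans_lt (π.pred_lt n hr)
  have hri : r ≤ π.t n (i + 1) := π.next_eq hi hpi ▸ (π.pred_le_iff hlast).1 le_rfl
  refine ⟨i, hi, ?_, hir, hri⟩
  rw [← π.next_eq hi ⟨le_rfl, π.t_lt n i hi⟩] at hri
  exact ((π.pred_le_iff ((π.t_lt n i hi).trans_le (π.t_le_t hi le_rfl))).2 hri).antisymm hpi.1

theorem eventually_lt_last (T : ℝ≥0) : ∀ᶠ n in atTop, T < π.t n (π.k n) :=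
  π.last_tendsto.eventually_gt_atTop T

theorem eventually_next_lt (T : ℝ≥0) {ε : ℝ≥0} (hε : 0 < ε) :
    ∀ᶠ n in atTop, ∀ s ≤ T, π.next n s < s + ε := by
  filter_upwards [π.eventually_lt_last T, π.mesh T ε hε] with n hlast hmesh s hs
  obtain ⟨i, hi, hsi⟩ := π.exists_mem_Ico (hs.trans_lt hlast)
  rw [π.next_eq hi hsi]
  exact (hmesh i hi (hsi.1.trans hs)).trans_le (by gcongr; exact hsi.1)

theorem tendsto_next_of_le {s : ℕ → ℝ≥0} {t : ℝ≥0} (hst : ∀ᶠ n in atTop, s n ≤ t)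
    (hts : ∀ᶠ n in atTop, t ≤ π.next n (s n)) :
    Tendsto (fun n => π.next n (s n)) atTop (𝓝[≥] t) := by
  refine tendsto_nhdsWithin_iff.2 ⟨tendsto_order.2 ⟨fun a ha => ?_, fun b hb => ?_⟩, hts⟩
  · exact hts.mono fun n hn => ha.trans_le hn
  · filter_upwards [hst, π.eventually_next_lt t (tsub_pos_of_lt hb)] with n hn hnext
    calc π.next n (s n) < s n + (b - t) := hnext _ hn
      _ ≤ t + (b - t) := by gcongr
      _ = b := add_tsub_cancel_of_le hb.le

theorem tendsto_next (s : ℝ≥0) : Tendsto (fun n => π.next n s) atTop (𝓝[≥] s) :=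
  π.tendsto_next_of_le (.of_forall fun _ => le_rfl)
    ((π.eventually_lt_last s).mono fun _ hn => (π.lt_next hn).le)

theorem tendsto_next_pred (t : ℝ≥0) :
    Tendsto (fun n => π.next n (π.pred n t)) atTop (𝓝[≥] t) :=
  π.tendsto_next_of_le (.of_forall fun n => π.pred_le n t)
    ((π.eventually_lt_last t).mono fun n hn =>
      (π.pred_le_iff ((π.pred_le n t).trans_lt hn)).1 le_rfl)

theorem tendsto_pred (r : ℝ≥0) : Tendsto (fun n => π.pred n r) atTop (𝓝 r) := by
  refine tendsto_order.2 ⟨fun a ha => ?_, fun b hb => ?_⟩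
  · filter_upwards [π.eventually_lt_last a, (tendsto_nhdsWithin_iff.1
      (π.tendsto_next a)).1.eventually (Iio_mem_nhds ha)] with n hlast hnext
    exact (π.lt_pred_iff hlast).2 hnext
  · exact .of_forall fun n => (π.pred_le n r).trans_lt hb

theorem tendsto_pred_nhdsLT {r : ℝ≥0} (hr : 0 < r) :
    Tendsto (fun n => π.pred n r) atTop (𝓝[<] r) :=
  tendsto_nhdsWithin_iff.2 ⟨π.tendsto_pred r, .of_forall fun n => π.pred_lt n hr⟩

variable {E : Type*} [NormedAddCommGroup E] (x : CadlagPath E)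

theorem stepApprox_apply {s : ℝ≥0} (hs : s < π.t n (π.k n)) :
    π.stepApprox n x s = x (π.next n s) := by
  obtain ⟨i, hi, hsi⟩ := π.exists_mem_Ico hs
  have hne : ∀ j ∈ Finset.range (π.k n), j ≠ i →
      (Ico (π.t n j) (π.t n (j + 1))).indicator (fun _ => x (π.t n (j + 1))) s = 0 := by
    refine fun j hj hji => indicator_of_notMem (fun hsj => hji ?_) _
    have hj := Finset.mem_range.1 hj
    have hij := π.lt_of_t_lt_t hi.le (hsi.1.trans_lt hsj.2)
    have hji := π.lt_of_t_lt_t hj.le (hsj.1.trans_lt hsi.2)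
    lia
  rw [π.next_eq hi hsi]
  exact (Finset.sum_eq_single_of_mem i (Finset.mem_range.2 hi) hne).trans (indicator_of_mem hsi _)

theorem tendsto_stepApprox_apply (s : ℝ≥0) :
    Tendsto (fun n => π.stepApprox n x s) atTop (𝓝 (x s)) := by
  refine ((x.cadlag s).1.tendsto.comp (π.tendsto_next s)).congr' ?_
  filter_upwards [π.eventually_lt_last s] with n hn using (π.stepApprox_apply x hn).symm

/- With a time change that sends each point `r` of a finite set to `pred n r`, the points `s` and
`next n (lam s)` lie on the same side of every `r`, by the Galois connection between `pred` and
`next`. -/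
theorem tendsto_stepApprox :
    Tendsto (fun n => π.stepApprox n x) atTop (@nhds _ (jOneTopology E) x) := by
  refine tendsto_jOneTopology_iff.2 fun T ε hε => ?_
  obtain ⟨S, hS⟩ := x.exists_finset_dist_le T hε
  filter_upwards [π.eventually_lt_last (T + 1), eventually_exists_orderIso_eqOn π.pred_zero S
    (fun r _ => π.tendsto_pred r) (lt_min hε one_pos)] with n hlast ⟨lam, hlam, hlamS⟩
  refine ⟨lam, fun s => (hlam s).trans (min_le_left _ _), fun s hs => ?_⟩
  have hlast : lam s < π.t n (π.k n) :=
    (le_add_of_dist_le_one ((hlam s).trans (min_le_right _ _)) hs).trans_lt hlast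
  change dist (x s) (π.stepApprox n x (lam s)) ≤ ε
  rw [π.stepApprox_apply x hlast]
  refine hS s hs _ fun r hr => ?_
  rw [← π.pred_le_iff hlast, ← hlamS hr, lam.le_iff_le]

theorem stepApprox_freezeAt {s : ℝ≥0} (hs : s < π.t n (π.k n)) (t : ℝ≥0) (c : E) :
    π.stepApprox n (x.freezeAt t c) s = (π.stepApprox n x).freezeAt (π.pred n t) c s := by
  rw [π.stepApprox_apply _ hs]
  rcases lt_or_ge s (π.pred n t) with hst | hst
  · rw [CadlagPath.freezeAt_of_lt hst, CadlagPath.freezeAt_of_lt ((π.lt_pred_iff hs).1 hst),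
      π.stepApprox_apply x hs]
  · rw [CadlagPath.freezeAt_of_le hst, CadlagPath.freezeAt_of_le ((π.pred_le_iff hs).1 hst)]

theorem tendsto_stepApprox_freezeAt_pred (t : ℝ≥0) (c : E) :
    Tendsto (fun n => (π.stepApprox n x).freezeAt (π.pred n t) c) atTop
      (@nhds _ (jOneTopology E) (x.freezeAt t c)) := by
  refine tendsto_jOneTopology_of_dist_le (π.tendsto_stepApprox _) fun T ε hε => ?_
  filter_upwards [π.eventually_lt_last T] with n hn s hs
  rw [π.stepApprox_freezeAt x (hs.trans_lt hn), dist_self]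
  exact hε.le

theorem exists_eventually_dist_stepApprox_left_le {t : ℝ≥0} (ht : 0 < t) {ε : ℝ} (hε : 0 < ε) :
    ∃ a < t, ∀ᶠ n in atTop, ∀ v ∈ Ico a (π.pred n t), dist (π.stepApprox n x v) (x.left t) ≤ ε := by
  obtain ⟨a, hat, ha⟩ := x.exists_dist_left_le ht hε
  refine ⟨a, hat, ?_⟩
  filter_upwards [π.eventually_lt_last t] with n hn v hv
  have hv' : v < π.t n (π.k n) := (hv.2.trans_le (π.pred_le n t)).trans hn
  rw [π.stepApprox_apply x hv']
  exact ha _ ⟨hv.1.trans (π.lt_next hv').le, (π.lt_pred_iff hv').1 hv.2⟩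

theorem exists_eventually_dist_stepApprox_right_le (t : ℝ≥0) {ε : ℝ} (hε : 0 < ε) :
    ∃ b > t, ∀ᶠ n in atTop, ∀ v ∈ Ico (π.pred n t) b, dist (π.stepApprox n x v) (x t) ≤ ε := by
  obtain ⟨b, htb, hb⟩ := x.exists_dist_right_le t hε
  obtain ⟨c, htc, hcb⟩ := exists_between htb
  refine ⟨c, htc, ?_⟩
  filter_upwards [π.eventually_lt_last c, π.eventually_next_lt c (tsub_pos_of_lt hcb)]
    with n hlast hnext v hv
  rw [π.stepApprox_apply x (hv.2.trans hlast)]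
  refine hb _ ⟨(π.pred_le_iff (hv.2.trans hlast)).1 hv.1, (hnext v hv.2.le).trans_le ?_⟩
  calc v + (b - c) ≤ c + (b - c) := by gcongr; exact hv.2.le
    _ = b := add_tsub_cancel_of_le hcb.le

variable {x} {t : ℝ≥0} {u : ℕ → ℝ≥0} (hu : Tendsto u atTop (𝓝 t))
include hu

theorem tendsto_stepApprox_freezeAt_right (hpu : ∀ᶠ n in atTop, π.pred n t ≤ u n) {c : ℕ → E}
    (hc : Tendsto c atTop (𝓝 (x t))) :
    Tendsto (fun n => (π.stepApprox n x).freezeAt (u n) (c n)) atTop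
      (@nhds _ (jOneTopology E) (x.stopAt t)) := by
  rw [CadlagPath.stopAt_eq_freezeAt]
  refine (CadlagPath.tendsto_freezeAt_iff hpu tendsto_const_nhds hc fun ε hε => ?_).1
    (π.tendsto_stepApprox_freezeAt_pred x t (x t))
  obtain ⟨b, htb, hb⟩ := π.exists_eventually_dist_stepApprox_right_le x t hε
  filter_upwards [hb, hu.eventually (Iio_mem_nhds htb)] with n hn hub v hv
  exact hn v ⟨hv.1, hv.2.trans hub⟩

theorem tendsto_stepApprox_freezeAt_left (ht : 0 < t) (hup : ∀ᶠ n in atTop, u n ≤ π.pred n t)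
    {c : ℕ → E} (hc : Tendsto c atTop (𝓝 (x.left t))) :
    Tendsto (fun n => (π.stepApprox n x).freezeAt (u n) (c n)) atTop
      (@nhds _ (jOneTopology E) (x.stopBefore t)) := by
  refine (CadlagPath.tendsto_freezeAt_iff hup hc tendsto_const_nhds fun ε hε => ?_).2
    (π.tendsto_stepApprox_freezeAt_pred x t (x.left t))
  obtain ⟨a, hat, ha⟩ := π.exists_eventually_dist_stepApprox_left_le x ht hε
  filter_upwards [ha, hu.eventually (Ioi_mem_nhds hat)] with n hn hau v hv
  exact hn v ⟨(le_of_lt hau).trans hv.1, hv.2⟩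

theorem tendsto_stepApprox_stopAt (hpu : ∀ᶠ n in atTop, π.pred n t ≤ u n) :
    Tendsto (fun n => (π.stepApprox n x).stopAt (u n)) atTop
      (@nhds _ (jOneTopology E) (x.stopAt t)) := by
  simp only [CadlagPath.stopAt_eq_freezeAt (π.stepApprox _ x)]
  refine π.tendsto_stepApprox_freezeAt_right hu hpu ?_
  refine Metric.nhds_basis_closedBall.tendsto_right_iff.2 fun ε hε => ?_
  obtain ⟨b, htb, hb⟩ := π.exists_eventually_dist_stepApprox_right_le x t hε
  filter_upwards [hb, hpu, hu.eventually (Iio_mem_nhds htb)] with n hn hpu hub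
  exact hn _ ⟨hpu, hub⟩

theorem tendsto_stepApprox_stopBefore_of_lt (hpu : ∀ᶠ n in atTop, π.pred n t < u n) :
    Tendsto (fun n => (π.stepApprox n x).stopBefore (u n)) atTop
      (@nhds _ (jOneTopology E) (x.stopAt t)) := by
  refine π.tendsto_stepApprox_freezeAt_right hu (hpu.mono fun _ => le_of_lt) ?_
  refine Metric.nhds_basis_closedBall.tendsto_right_iff.2 fun ε hε => ?_
  obtain ⟨b, htb, hb⟩ := π.exists_eventually_dist_stepApprox_right_le x t hε
  filter_upwards [hb, hpu, hu.eventually (Iio_mem_nhds htb)] with n hn hpu hub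
  exact CadlagPath.dist_left_le _ hpu fun v hv => hn v ⟨hv.1, hv.2.trans hub⟩

theorem tendsto_stepApprox_stopAt_of_lt (hup : ∀ᶠ n in atTop, u n < π.pred n t) :
    Tendsto (fun n => (π.stepApprox n x).stopAt (u n)) atTop
      (@nhds _ (jOneTopology E) (x.stopBefore t)) := by
  obtain ⟨n, hn⟩ := hup.exists
  have ht : 0 < t := (pos_of_gt hn).trans_le (π.pred_le n t)
  simp only [CadlagPath.stopAt_eq_freezeAt]
  refine π.tendsto_stepApprox_freezeAt_left hu ht (hup.mono fun _ => le_of_lt) ?_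
  refine Metric.nhds_basis_closedBall.tendsto_right_iff.2 fun ε hε => ?_
  obtain ⟨a, hat, ha⟩ := π.exists_eventually_dist_stepApprox_left_le x ht hε
  filter_upwards [ha, hup, hu.eventually (Ioi_mem_nhds hat)] with n hn hup hau
  exact hn _ ⟨le_of_lt hau, hup⟩

theorem tendsto_stepApprox_stopBefore (hup : ∀ᶠ n in atTop, u n ≤ π.pred n t) :
    Tendsto (fun n => (π.stepApprox n x).stopBefore (u n)) atTop
      (@nhds _ (jOneTopology E) (x.stopBefore t)) := by
  rcases eq_zero_or_pos t with rfl | ht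
  · have hu0 : ∀ᶠ n in atTop, u n = 0 :=
      hup.mono fun n hn => le_antisymm (hn.trans_eq (π.pred_zero n)) zero_le
    rw [CadlagPath.stopBefore_eq_stopAt _ x.left_zero]
    refine (π.tendsto_stepApprox_stopAt hu (hu0.mono fun n hn => ?_)).congr' ?_
    · rw [π.pred_zero, hn]
    · filter_upwards [hu0] with n hn
      rw [hn, CadlagPath.stopBefore_eq_stopAt _ (CadlagPath.left_zero _)]
  refine π.tendsto_stepApprox_freezeAt_left hu ht hup ?_
  refine Metric.nhds_basis_closedBall.tendsto_right_iff.2 fun ε hε => ?_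
  obtain ⟨a, hat, ha⟩ := π.exists_eventually_dist_stepApprox_left_le x ht hε
  filter_upwards [ha, hup, hu.eventually (Ioi_mem_nhds hat)] with n hn hup hau
  exact CadlagPath.dist_left_le _ hau fun v hv => hn v ⟨hv.1, hv.2.trans_le hup⟩

end PartitionSeq

section domain

variable {m : ℕ} {π : PartitionSeq} {Ω : Set (CadlagPath (EuclideanSpace ℝ (Fin m)))}

theorem evalAt_of_mem (F : domain Ω → ℝ) {t : ℝ≥0} {y : CadlagPath (EuclideanSpace ℝ (Fin m))}
    (h : (t, y) ∈ domain Ω) : evalAt F t y = F ⟨(t, y), h⟩ := dif_pos h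

section convergence

variable {τ : TopologicalSpace (CadlagPath (EuclideanSpace ℝ (Fin m)))} {ι : Type*} {l : Filter ι}
  {u : ι → ℝ≥0} {t : ℝ≥0} {w : ι → CadlagPath (EuclideanSpace ℝ (Fin m))}
  {z : CadlagPath (EuclideanSpace ℝ (Fin m))}

theorem tendsto_evalAt {F : domain Ω → ℝ} (hF : Continuous[prodTopologyOn τ Ω, inferInstance] F)
    (hz : (t, z) ∈ domain Ω) (hmem : ∀ᶠ i in l, (u i, w i) ∈ domain Ω) (hu : Tendsto u l (𝓝 t))
    (hw : Tendsto w l (@nhds _ τ z)) :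
    Tendsto (fun i => evalAt F (u i) (w i)) l (𝓝 (evalAt F t z)) := by
  have hrestrict : (domain Ω).domRestrict (fun p => evalAt F p.1 p.2) = F :=
    funext fun p => evalAt_of_mem F p.2
  have hcont : ContinuousOn (fun p => evalAt F p.1 p.2) (domain Ω) := by
    rwa [continuousOn_iff_continuous_domRestrict, hrestrict]
  exact (hcont (t, z) hz).tendsto.comp (tendsto_nhdsWithin_iff.2 ⟨hu.prodMk_nhds hw, hmem⟩)

theorem tendsto_of_piTopology_le (hle : piTopology π Ω ≤ prodTopologyOn τ Ω)
    (hz : (t, z) ∈ domain Ω) (hmem : ∀ᶠ i in l, (u i, w i) ∈ domain Ω)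
    (h : ∀ F : domain Ω → ℝ, IsPiRegular π F →
      Tendsto (fun i => evalAt F (u i) (w i)) l (𝓝 (evalAt F t z))) :
    Tendsto w l (@nhds _ τ z) := by
  rcases l.eq_or_neBot with rfl | _
  · exact tendsto_bot
  obtain ⟨f, hf⟩ := (hmem.mono fun i hi =>
    (⟨⟨_, hi⟩, rfl⟩ : ∃ p : domain Ω, p.1 = (u i, w i))).choice
  have hpi : Tendsto f l (@nhds _ (piTopology π Ω) ⟨_, hz⟩) := by
    rw [nhds_iInf, tendsto_iInf]
    rintro ⟨F, hF⟩
    rw [nhds_induced, tendsto_comap_iff]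
    change Tendsto (fun i => F (f i)) l (𝓝 (F ⟨_, hz⟩))
    rw [← evalAt_of_mem F hz]
    refine (h F hF).congr' (hf.mono fun i hi => ?_)
    rw [evalAt_of_mem F (hi ▸ (f i).2)]
    exact congrArg F (Subtype.ext hi.symm)
  have hprod := hpi.mono_right (nhds_mono hle)
  rw [nhds_induced, tendsto_comap_iff, nhds_prod_eq] at hprod
  exact hprod.snd.congr' (hf.mono fun i hi => congrArg Prod.snd hi)

end convergence

theorem continuous_piTopology {F : domain Ω → ℝ} (hF : IsPiRegular π F) :
    Continuous[piTopology π Ω, inferInstance] F :=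
  continuous_iInf_dom (i := ⟨F, hF⟩) continuous_induced_dom

theorem completelyRegularSpace_prodTopologyOn
    {τ : TopologicalSpace (CadlagPath (EuclideanSpace ℝ (Fin m)))}
    (hτ : @CompletelyRegularSpace _ τ) (Ω : Set (CadlagPath (EuclideanSpace ℝ (Fin m)))) :
    @CompletelyRegularSpace _ (prodTopologyOn τ Ω) :=
  completelyRegularSpace_induced (completelyRegularSpace_inf
    (completelyRegularSpace_induced inferInstance _) (completelyRegularSpace_induced hτ _)) _

theorem prodTopologyOn_mono {σ τ : TopologicalSpace (CadlagPath (EuclideanSpace ℝ (Fin m)))}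
    (h : σ ≤ τ) (Ω : Set (CadlagPath (EuclideanSpace ℝ (Fin m)))) :
    prodTopologyOn σ Ω ≤ prodTopologyOn τ Ω :=
  induced_mono (inf_le_inf le_rfl (induced_mono h))

theorem isPiRegular_of_continuous (hΩ : π.IsGeneric Ω) {F : domain Ω → ℝ}
    (hF : Continuous[jOneTopologyOn Ω, inferInstance] F) : IsPiRegular π F where
  left_a x hx t := by
    rw [← Iio_union_right, nhdsWithin_union, nhdsWithin_singleton]
    refine .sup ?_ (tendsto_pure_nhds _ _)
    exact tendsto_evalAt hF (mem_domain_stopBefore hΩ hx t)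
      (.of_forall (mem_domain_stopBefore hΩ hx)) (tendsto_id.mono_right nhdsWithin_le_nhds)
      (CadlagPath.tendsto_freezeAt_left tendsto_id (x.tendsto_left_nhdsLT t))
  left_b x hx t := by
    refine tendsto_evalAt hF (mem_domain_stopBefore hΩ hx t) (.of_forall (mem_domain_stopAt hx))
      (tendsto_id.mono_right nhdsWithin_le_nhds) ?_
    exact (CadlagPath.tendsto_freezeAt_left tendsto_id (x.tendsto_left t)).congr
      fun s => (x.stopAt_eq_freezeAt s).symm
  left_c x hx t u hu hup := tendsto_evalAt hF (mem_domain_stopBefore hΩ hx t)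
    ((eventually_mem_domain hΩ hx hu).mono fun _ => And.right) hu
    (π.tendsto_stepApprox_stopBefore hu hup)
  left_d x hx t u hu hup := tendsto_evalAt hF (mem_domain_stopBefore hΩ hx t)
    ((eventually_mem_domain hΩ hx hu).mono fun _ => And.left) hu
    (π.tendsto_stepApprox_stopAt_of_lt hu hup)
  right_a x hx t := by
    rw [← Ioi_union_left, nhdsWithin_union, nhdsWithin_singleton]
    refine .sup ?_ (tendsto_pure_nhds _ _)
    refine tendsto_evalAt hF (mem_domain_stopAt hx t) (.of_forall (mem_domain_stopAt hx))
      (tendsto_id.mono_right nhdsWithin_le_nhds) ?_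
    exact (CadlagPath.tendsto_freezeAt_right tendsto_id
      ((x.cadlag t).1.tendsto.mono_left (nhdsWithin_mono _ Ioi_subset_Ici_self))).congr
      fun s => (x.stopAt_eq_freezeAt s).symm
  right_b x hx t := tendsto_evalAt hF (mem_domain_stopAt hx t)
    (.of_forall (mem_domain_stopBefore hΩ hx)) (tendsto_id.mono_right nhdsWithin_le_nhds)
    (CadlagPath.tendsto_freezeAt_right tendsto_id (x.tendsto_left_nhdsGT t))
  right_c x hx t u hu hpu := tendsto_evalAt hF (mem_domain_stopAt hx t)
    ((eventually_mem_domain hΩ hx hu).mono fun _ => And.left) hu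
    (π.tendsto_stepApprox_stopAt hu hpu)
  right_d x hx t u hu hpu := tendsto_evalAt hF (mem_domain_stopAt hx t)
    ((eventually_mem_domain hΩ hx hu).mono fun _ => And.right) hu
    (π.tendsto_stepApprox_stopBefore_of_lt hu hpu)

theorem piTopology_le_jOneTopologyOn (hΩ : π.IsGeneric Ω) : piTopology π Ω ≤ jOneTopologyOn Ω :=
  le_of_forall_continuous_real
    (completelyRegularSpace_prodTopologyOn completelyRegularSpace_jOneTopology Ω)
    fun _ hF => continuous_piTopology (isPiRegular_of_continuous hΩ hF)

/- A functional that does not see the path from time `t` on cannot tell `x_t` from `x_{t-}`, so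
that the eight conditions in `IsPiRegular` reduce to two. -/
theorem isPiRegular_of_eqOn_Iio (hΩ : π.IsGeneric Ω)
    {G : ℝ≥0 → CadlagPath (EuclideanSpace ℝ (Fin m)) → ℝ}
    (hloc : ∀ t (y z : CadlagPath _), EqOn y z (Iio t) → G t y = G t z)
    (hcont : ∀ x ∈ Ω, Continuous (G · x))
    (happrox : ∀ x ∈ Ω, ∀ t, ∀ u : ℕ → ℝ≥0, Tendsto u atTop (𝓝 t) →
      Tendsto (fun n => G (u n) (π.stepApprox n x)) atTop (𝓝 (G t x))) :
    IsPiRegular π fun p : domain Ω => G p.1.1 p.1.2 := by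
  have hAt {t} {y : CadlagPath _} (h : (t, y.stopAt t) ∈ domain Ω) :
      evalAt (fun p : domain Ω => G p.1.1 p.1.2) t (y.stopAt t) = G t y :=
    (evalAt_of_mem _ h).trans (hloc t _ _ fun s hs => CadlagPath.stopAt_apply_of_le (le_of_lt hs))
  have hBefore {t} {y : CadlagPath _} (h : (t, y.stopBefore t) ∈ domain Ω) :
      evalAt (fun p : domain Ω => G p.1.1 p.1.2) t (y.stopBefore t) = G t y :=
    (evalAt_of_mem _ h).trans (hloc t _ _ fun s hs => if_pos hs)
  have hAt' {x} (hx : x ∈ Ω) t := hAt (mem_domain_stopAt hx t)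
  have hBefore' {x} (hx : x ∈ Ω) t := hBefore (mem_domain_stopBefore hΩ hx t)
  have hpath {x} (hx : x ∈ Ω) (t : ℝ≥0) (S : Set ℝ≥0) : Tendsto (G · x) (𝓝[S] t) (𝓝 (G t x)) :=
    (hcont x hx).continuousWithinAt
  have hmem {x} (hx : x ∈ Ω) {t : ℝ≥0} {u : ℕ → ℝ≥0} (hu : Tendsto u atTop (𝓝 t)) :=
    eventually_mem_domain hΩ hx hu
  exact
    { left_a x hx t := by simpa only [hBefore' hx] using hpath hx t (Iic t)
      left_b x hx t := by simpa only [hAt' hx, hBefore' hx] using hpath hx t (Iio t)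
      left_c x hx t u hu _ := by
        rw [hBefore' hx]
        exact (happrox x hx t u hu).congr' ((hmem hx hu).mono fun n hn => (hBefore hn.2).symm)
      left_d x hx t u hu _ := by
        rw [hBefore' hx]
        exact (happrox x hx t u hu).congr' ((hmem hx hu).mono fun n hn => (hAt hn.1).symm)
      right_a x hx t := by simpa only [hAt' hx] using hpath hx t (Ici t)
      right_b x hx t := by simpa only [hAt' hx, hBefore' hx] using hpath hx t (Ioi t)
      right_c x hx t u hu _ := by
        rw [hAt' hx]
        exact (happrox x hx t u hu).congr' ((hmem hx hu).mono fun n hn => (hAt hn.1).symm)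
      right_d x hx t u hu _ := by
        rw [hAt' hx]
        exact (happrox x hx t u hu).congr' ((hmem hx hu).mono fun n hn => (hBefore hn.2).symm) }

end domain

section jumps

theorem CadlagPath.left_congr {E : Type*} [NormedAddCommGroup E] {x y : CadlagPath E} {t : ℝ≥0}
    (ht : 0 < t) (hxy : EqOn x y (Iio t)) : x.left t = y.left t := by
  have := nhdsLT_neBot_of_exists_lt ⟨0, ht⟩
  exact tendsto_nhds_unique (x.tendsto_left t)
    ((y.tendsto_left t).congr' (hxy.eventuallyEq_nhdsWithin (s := Iio t)).symm)

theorem PartitionSeq.left_eq_of_tendsto_stepApprox (π : PartitionSeq) {E : Type*}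
    [NormedAddCommGroup E] {x : CadlagPath E} {t : ℝ≥0} (ht : 0 < t)
    (h : Tendsto (fun n => (π.stepApprox n x).stopAt t) atTop
      (@nhds _ (locUnifTopology E) (x.stopAt t))) : x.left t = x t := by
  have hdist : Tendsto (fun n => dist (x (π.pred n t)) (x (π.next n (π.pred n t)))) atTop
      (𝓝 (dist (x.left t) (x t))) :=
    ((x.tendsto_left t).comp (π.tendsto_pred_nhdsLT ht)).dist
      ((x.cadlag t).1.tendsto.comp (π.tendsto_next_pred t))
  refine dist_le_zero.1 (le_of_forall_pos_le_add fun ε hε => le_of_tendsto hdist ?_)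
  filter_upwards [tendsto_locUnifTopology_iff.1 h t ε hε, π.eventually_lt_last t] with n hn hlast
  have hpred := hn _ (π.pred_le n t)
  rw [CadlagPath.stopAt_apply_of_le (π.pred_le n t), CadlagPath.stopAt_apply_of_le (π.pred_le n t),
    π.stepApprox_apply x ((π.pred_le n t).trans_lt hlast)] at hpred
  linarith

variable {m : ℕ} {π : PartitionSeq} {Ω : Set (CadlagPath (EuclideanSpace ℝ (Fin m)))}
  [Nontrivial (EuclideanSpace ℝ (Fin m))]

theorem exists_left_ne (hΩ : π.IsGeneric Ω) {t : ℝ≥0} (ht : 0 < t) :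
    ∃ y ∈ Ω, y.left t ≠ y t := by
  obtain ⟨x, hx⟩ := hΩ.nonempty
  obtain ⟨U, -, hU, -, hmem⟩ := hΩ.perturb_mem x hx t
  have := Module.punctured_nhds_neBot ℝ (EuclideanSpace ℝ (Fin m)) 0
  obtain ⟨e, he, hne⟩ := (infinite_of_mem_nhds 0 hU).nontrivial.exists_ne (x.left t - x t)
  have hleft : (x.perturb t e).left t = x.left t :=
    CadlagPath.left_congr ht fun s (hs : s < t) => by
      simp [CadlagPath.perturb, CadlagPath.stopAt, hs.le, hs]
  have hval : x.perturb t e t = x t + e := by simp [CadlagPath.perturb, CadlagPath.stopAt]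
  refine ⟨_, hmem e he, fun heq => hne ?_⟩
  rw [← hleft, heq, hval, add_sub_cancel_left]

theorem not_piTopology_le_unifTopologyOn (hΩ : π.IsGeneric Ω) :
    ¬ piTopology π Ω ≤ unifTopologyOn Ω := by
  intro hle
  obtain ⟨y, hy, hjump⟩ := exists_left_ne hΩ one_pos
  exact hjump <| π.left_eq_of_tendsto_stepApprox one_pos <|
    tendsto_of_piTopology_le hle (mem_domain_stopAt hy 1)
      ((eventually_mem_domain hΩ hy tendsto_const_nhds).mono fun _ => And.left)
      fun F hF => hF.right_c y hy 1 (fun _ => 1) tendsto_const_nhds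
        (.of_forall fun n => π.pred_le n 1)

theorem exists_continuous_unifTopologyOn_not_piTopology (hΩ : π.IsGeneric Ω) :
    ∃ F : domain Ω → ℝ, Continuous[unifTopologyOn Ω, inferInstance] F ∧
      ¬ Continuous[piTopology π Ω, inferInstance] F := by
  by_contra! h
  exact not_piTopology_le_unifTopologyOn hΩ (le_of_forall_continuous_real
    (completelyRegularSpace_prodTopologyOn completelyRegularSpace_locUnifTopology Ω) h)

end jumps

namespace PartitionSeq

variable (π : PartitionSeq) {n : ℕ} {E : Type*} [NormedAddCommGroup E] [NormedSpace ℝ E]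
  (x : CadlagPath E)

theorem linApprox_apply {i : ℕ} (hi : i < π.k n) {s : ℝ≥0}
    (hs : s ∈ Icc (π.t n i) (π.t n (i + 1))) :
    π.linApprox n x s = AffineMap.lineMap (x (π.t n i)) (x (π.t n (i + 1)))
      ((s - π.t n i : ℝ) / (π.t n (i + 1) - π.t n i)) := by
  let coeff (j : ℕ) : ℝ := ((min s (π.t n (j + 1)) : ℝ≥0) - (min s (π.t n j) : ℝ≥0)) /
    (π.t n (j + 1) - π.t n j)
  have hbefore : ∀ j ∈ Finset.range i, coeff j = 1 := by
    intro j hj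
    have hj : j < i := Finset.mem_range.1 hj
    have hlt := π.t_lt n j (hj.trans hi)
    have hle : π.t n (j + 1) ≤ s := (π.t_le_t hj hi.le).trans hs.1
    simp only [coeff, min_eq_right hle, min_eq_right (hlt.le.trans hle)]
    exact div_self (sub_pos.2 (NNReal.coe_lt_coe.2 hlt)).ne'
  have hafter : ∀ j ∈ Finset.range (π.k n), j ∉ Finset.range (i + 1) → coeff j = 0 := by
    intro j hj hij
    rw [Finset.mem_range] at hj hij
    have hle : s ≤ π.t n j := hs.2.trans (π.t_le_t (not_lt.1 hij) hj.le)
    simp only [coeff, min_eq_left hle, min_eq_left (hle.trans (π.t_lt n j hj).le), sub_self,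
      zero_div]
  calc π.linApprox n x s
      = x 0 + ∑ j ∈ Finset.range (π.k n), coeff j • (x (π.t n (j + 1)) - x (π.t n j)) := rfl
    _ = x 0 + ∑ j ∈ Finset.range i, (x (π.t n (j + 1)) - x (π.t n j)) +
          coeff i • (x (π.t n (i + 1)) - x (π.t n i)) := by
        rw [← Finset.sum_subset (Finset.range_mono (Nat.succ_le_of_lt hi))
          fun j hj hij => by rw [hafter j hj hij, zero_smul], Finset.sum_range_succ, add_assoc]
        congr 2
        exact Finset.sum_congr rfl fun j hj => by rw [hbefore j hj, one_smul]
    _ = _ := by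
        rw [Finset.sum_range_sub (fun j => x (π.t n j)), π.t_zero, add_sub_cancel,
          AffineMap.lineMap_apply_module', add_comm]
        simp only [coeff, min_eq_left hs.2, min_eq_right hs.1]

theorem exists_lipschitzWith_linApprox (n : ℕ) :
    ∃ K, LipschitzWith K (π.linApprox n x).toFun := by
  have hmin (a : ℝ≥0) : LipschitzWith 1 fun s : ℝ≥0 => ((min s a : ℝ≥0) : ℝ) :=
    (LipschitzWith.subtype_val {r : ℝ | 0 ≤ r}).min_const (a : ℝ)
  have hterm (a b : ℝ≥0) (d : ℝ) (v : E) : ∃ K, LipschitzWith K fun s : ℝ≥0 =>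
      (((min s b : ℝ≥0) - (min s a : ℝ≥0) : ℝ) / d) • v := by
    have hlip := (ContinuousLinearMap.toSpanSingleton ℝ (d⁻¹ • v)).lipschitz.comp
      ((hmin b).sub (hmin a))
    simp only [Function.comp_def, ContinuousLinearMap.toSpanSingleton_apply, smul_smul,
      ← div_eq_mul_inv] at hlip
    exact ⟨_, hlip⟩
  choose K hK using hterm
  suffices hsum : ∀ A : Finset ℕ, ∃ C, LipschitzWith C fun s : ℝ≥0 => ∑ i ∈ A,
      (((min s (π.t n (i + 1)) : ℝ≥0) - (min s (π.t n i) : ℝ≥0) : ℝ) /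
        (π.t n (i + 1) - π.t n i : ℝ)) • (x (π.t n (i + 1)) - x (π.t n i)) by
    obtain ⟨C, hC⟩ := hsum (Finset.range (π.k n))
    exact ⟨0 + C, (LipschitzWith.const (x 0)).add hC⟩
  intro A
  induction A using Finset.induction_on with
  | empty => exact ⟨0, by simpa only [Finset.sum_empty] using LipschitzWith.const 0⟩
  | insert i A hi ih =>
    obtain ⟨C, hC⟩ := ih
    simp only [Finset.sum_insert hi]
    exact ⟨_, (hK _ _ _ _).add hC⟩

theorem tendsto_linApprox {x : CadlagPath E} (hx : Continuous x.toFun) :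
    Tendsto (fun n => π.linApprox n x) atTop (@nhds _ (locUnifTopology E) x) := by
  refine tendsto_locUnifTopology_iff.2 fun T ε hε => ?_
  obtain ⟨δ, hδ, hxδ⟩ := Metric.uniformContinuousOn_iff.1
    ((isCompact_Icc (a := 0) (b := T + 1)).uniformContinuousOn_of_continuous hx.continuousOn) ε hε
  lift δ to ℝ≥0 using hδ.le
  filter_upwards [π.eventually_lt_last T, π.mesh T (min δ 1) (lt_min hδ one_pos)]
    with n hlast hmesh s hs
  obtain ⟨i, hi, hsi⟩ := π.exists_mem_Ico (hs.trans_lt hlast)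
  have hcell : (π.t n (i + 1) : ℝ) < π.t n i + min (δ : ℝ) 1 :=
    mod_cast hmesh i hi (hsi.1.trans hs)
  obtain ⟨hcellδ, hcell1⟩ := lt_min_iff.1 (sub_lt_iff_lt_add'.2 hcell)
  have his : (π.t n i : ℝ) ≤ s := hsi.1
  have hsi' : (s : ℝ) ≤ π.t n (i + 1) := hsi.2.le
  have hball : ∀ v ∈ Icc (π.t n i) (π.t n (i + 1)), x v ∈ Metric.ball (x s) ε := by
    intro v hv
    have hvi : (π.t n i : ℝ) ≤ v := hv.1
    have hvi' : (v : ℝ) ≤ π.t n (i + 1) := hv.2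
    have hvT : v ≤ T + 1 := by
      rw [← NNReal.coe_le_coe, NNReal.coe_add, NNReal.coe_one]
      linarith [NNReal.coe_le_coe.2 hs]
    refine hxδ v ⟨zero_le, hvT⟩ s ⟨zero_le, hs.trans le_self_add⟩ ?_
    rw [NNReal.dist_eq, abs_lt]
    constructor <;> linarith
  have hle := (π.t_lt n i hi).le
  have hmem := (convex_ball (x s) ε).lineMap_mem (hball _ (left_mem_Icc.2 hle))
    (hball _ (right_mem_Icc.2 hle)) (t := (s - π.t n i : ℝ) / (π.t n (i + 1) - π.t n i))
    ⟨div_nonneg (by linarith) (by linarith), div_le_one_of_le₀ (by linarith) (by linarith)⟩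
  rw [← π.linApprox_apply x hi (Ico_subset_Icc_self hsi)] at hmem
  exact Metric.mem_ball'.1 hmem

end PartitionSeq

theorem tendsto_apply_of_tendsto_jOneTopology {E ι : Type*} [NormedAddCommGroup E] {l : Filter ι}
    {f : ι → CadlagPath E} {z : CadlagPath E} {v : ι → ℝ≥0} {t : ℝ≥0}
    (hf : Tendsto f l (@nhds _ (jOneTopology E) z)) (hz : ContinuousAt z.toFun t)
    (hv : Tendsto v l (𝓝 t)) : Tendsto (fun i => f i (v i)) l (𝓝 (z t)) := by
  refine Metric.nhds_basis_closedBall.tendsto_right_iff.2 fun ε hε => ?_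
  obtain ⟨δ, hδ, hzδ⟩ := Metric.continuousAt_iff.1 hz (ε / 2) (half_pos hε)
  have hη : 0 < min (min (ε / 2) (δ / 2)) (1 / 2) := by positivity
  filter_upwards [tendsto_jOneTopology_iff.1 hf (t + 1) _ hη,
    hv.eventually (Metric.ball_mem_nhds t hη)] with i hfi hvi
  obtain ⟨lam, hlam, hdist⟩ := hfi
  obtain ⟨s, hs⟩ := lam.surjective (v i)
  have hst : dist s t < min (min (ε / 2) (δ / 2)) (1 / 2) + min (min (ε / 2) (δ / 2)) (1 / 2) :=
    (dist_triangle_left s t (lam s)).trans_lt (add_lt_add_of_le_of_lt (hlam s) (by rwa [hs]))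
  have hsδ : dist s t < δ := hst.trans_le <|
    (add_le_add ((min_le_left _ _).trans (min_le_right _ _))
      ((min_le_left _ _).trans (min_le_right _ _))).trans_eq (add_halves δ)
  have hs1 : dist s t ≤ 1 := hst.le.trans <|
    (add_le_add (min_le_right _ _) (min_le_right _ _)).trans_eq (add_halves 1)
  calc dist (f i (v i)) (z t) ≤ dist (z s) (f i (v i)) + dist (z s) (z t) :=
        dist_triangle_left _ _ _
    _ ≤ ε / 2 + ε / 2 := by
        refine add_le_add ?_ (hzδ hsδ).le
        rw [← hs]
        exact (hdist s (le_add_of_dist_le_one hs1 le_rfl)).trans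
          ((min_le_left _ _).trans (min_le_left _ _))
    _ = ε := add_halves ε

theorem sq_apply_sub_le_of_lipschitzOnWith {ι : Type*} [Fintype ι] {f : ℝ≥0 → EuclideanSpace ℝ ι}
    {K η : ℝ≥0} {S : Set ℝ≥0} (hf : LipschitzOnWith K f S) {a b : ℝ≥0} (ha : a ∈ S) (hb : b ∈ S)
    (hab : a ≤ b) (hη : b ≤ a + η) (j : ι) : (f b j - f a j) ^ 2 ≤ K ^ 2 * η * (b - a : ℝ) := by
  have hgap : (0 : ℝ) ≤ b - a := sub_nonneg.2 hab
  have hgapη : (b : ℝ) - a ≤ η := sub_le_iff_le_add'.2 (mod_cast hη)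
  have hdist : |f b j - f a j| ≤ K * (b - a) := by
    calc |f b j - f a j| ≤ ‖f b - f a‖ := PiLp.norm_apply_le (f b - f a) j
      _ = dist (f b) (f a) := (dist_eq_norm _ _).symm
      _ ≤ K * dist b a := hf.dist_le_mul _ hb _ ha
      _ = K * (b - a) := by rw [NNReal.dist_eq, abs_of_nonneg hgap]
  calc (f b j - f a j) ^ 2
      ≤ (K * (b - a)) ^ 2 := sq_le_sq' (abs_le.1 hdist).1 (abs_le.1 hdist).2
    _ = K ^ 2 * (b - a) * (b - a) := by ring
    _ ≤ K ^ 2 * η * (b - a) := by gcongr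

namespace PartitionSeq

variable {m : ℕ} (π : PartitionSeq) (x : CadlagPath (EuclideanSpace ℝ (Fin m))) (j : Fin m)

theorem qvApprox_apply_diag (n : ℕ) (s : ℝ≥0) :
    π.qvApprox n x s j j = ∑ i ∈ (Finset.range (π.k n)).filter (π.t n · ≤ s),
      (x (π.t n (i + 1)) j - x (π.t n i) j) ^ 2 := by
  change (∑ i ∈ Finset.range (π.k n), _ : Matrix (Fin m) (Fin m) ℝ) j j = _
  rw [Matrix.sum_apply, Finset.sum_filter]
  refine Finset.sum_congr rfl fun i _ => ?_
  by_cases his : π.t n i ≤ s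
  · rw [indicator_of_mem (mem_Ici.2 his), if_pos his, Matrix.vecMulVec_apply, sq]
  · rw [indicator_of_notMem (notMem_Ici.2 (not_le.1 his)), if_neg his, Matrix.zero_apply]

theorem sq_next_pred_sub_le {n : ℕ} {s t : ℝ≥0} (hs : s < π.pred n t) (ht : t < π.t n (π.k n)) :
    (x (π.next n (π.pred n t)) j - x (π.pred n t) j) ^ 2 ≤
      π.qvApprox n x (π.pred n t) j j - π.qvApprox n x s j j := by
  obtain ⟨i, hi, hpred, hti⟩ := π.exists_pred_eq (hs.trans_le (π.pred_le n t)).pos ht.le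
  rw [hpred] at hs ⊢
  rw [π.next_eq hi (left_mem_Ico.2 (π.t_lt n i hi)), qvApprox_apply_diag, qvApprox_apply_diag,
    le_sub_iff_add_le, ← Finset.sum_insert (f := fun i => (x (π.t n (i + 1)) j - x (π.t n i) j) ^ 2)
      (by simp [hs])]
  refine Finset.sum_le_sum_of_subset_of_nonneg ?_ fun _ _ _ => sq_nonneg _
  refine Finset.insert_subset (by simp [hi]) fun l hl => ?_
  rw [Finset.mem_filter] at hl ⊢
  exact ⟨hl.1, hl.2.trans hs.le⟩

theorem qvApprox_apply_diag_le {n : ℕ} {s c K η : ℝ≥0} (hK : LipschitzOnWith K x.toFun (Iio c))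
    (hc : ∀ i < π.k n, π.t n i ≤ s → π.t n (i + 1) < c)
    (hη : ∀ i < π.k n, π.t n i ≤ s → π.t n (i + 1) ≤ π.t n i + η) :
    π.qvApprox n x s j j ≤ K ^ 2 * η * c := by
  have hmono : ∀ i < π.k n,
      ((min (π.t n i) c : ℝ≥0) : ℝ) ≤ (min (π.t n (i + 1)) c : ℝ≥0) := fun i hi =>
    NNReal.coe_le_coe.2 (min_le_min_right c (π.t_lt n i hi).le)
  have hterm : ∀ i < π.k n, π.t n i ≤ s → (x (π.t n (i + 1)) j - x (π.t n i) j) ^ 2 ≤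
      K ^ 2 * η * ((min (π.t n (i + 1)) c : ℝ≥0) - (min (π.t n i) c : ℝ≥0)) := by
    intro i hi his
    have hlt := π.t_lt n i hi
    have hic := hc i hi his
    rw [min_eq_left hic.le, min_eq_left (hlt.trans hic).le]
    exact sq_apply_sub_le_of_lipschitzOnWith hK (hlt.trans hic) hic hlt.le (hη i hi his) j
  calc π.qvApprox n x s j j
      ≤ ∑ i ∈ (Finset.range (π.k n)).filter (π.t n · ≤ s),
          K ^ 2 * η * ((min (π.t n (i + 1)) c : ℝ≥0) - (min (π.t n i) c : ℝ≥0) : ℝ) := by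
        rw [qvApprox_apply_diag]
        refine Finset.sum_le_sum fun i hi => ?_
        rw [Finset.mem_filter, Finset.mem_range] at hi
        exact hterm i hi.1 hi.2
    _ ≤ ∑ i ∈ Finset.range (π.k n),
          K ^ 2 * η * ((min (π.t n (i + 1)) c : ℝ≥0) - (min (π.t n i) c : ℝ≥0) : ℝ) :=
        Finset.sum_le_sum_of_subset_of_nonneg (Finset.filter_subset _ _) fun i hi _ =>
          mul_nonneg (by positivity) (sub_nonneg.2 (hmono i (Finset.mem_range.1 hi)))
    _ = K ^ 2 * η * (min (π.t n (π.k n)) c : ℝ≥0) := by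
        rw [← Finset.mul_sum, Finset.sum_range_sub (fun i => ((min (π.t n i) c : ℝ≥0) : ℝ)),
          π.t_zero, min_eq_left zero_le, NNReal.coe_zero, sub_zero]
    _ ≤ K ^ 2 * η * c := by
        gcongr
        exact min_le_right _ _

end PartitionSeq

namespace PartitionSeq.HasQuadVar

variable {m : ℕ} {π : PartitionSeq} {x : CadlagPath (EuclideanSpace ℝ (Fin m))}
  {Q : CadlagPath (Matrix (Fin m) (Fin m) ℝ)}

theorem tendsto_qvApprox_apply (h : π.HasQuadVar x Q) (hQ : Continuous Q.toFun) {v : ℕ → ℝ≥0}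
    {t : ℝ≥0} (hv : Tendsto v atTop (𝓝 t)) (i j : Fin m) :
    Tendsto (fun n => π.qvApprox n x (v n) i j) atTop (𝓝 (Q t i j)) :=
  ((continuous_id.matrix_elem i j).tendsto (Q t)).comp
    (tendsto_apply_of_tendsto_jOneTopology h hQ.continuousAt hv)

theorem sq_jump_le (h : π.HasQuadVar x Q) (hQ : Continuous Q.toFun) {s t : ℝ≥0} (hst : s < t)
    (j : Fin m) : (x.jump t j) ^ 2 ≤ Q t j j - Q s j j := by
  have hcoord : Continuous fun y : EuclideanSpace ℝ (Fin m) => y j := by fun_prop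
  have hlim : Tendsto (fun n => (x (π.next n (π.pred n t)) j - x (π.pred n t) j) ^ 2) atTop
      (𝓝 ((x t j - x.left t j) ^ 2)) :=
    (((hcoord.tendsto _).comp ((x.cadlag t).1.tendsto.comp (π.tendsto_next_pred t))).sub
      ((hcoord.tendsto _).comp ((x.tendsto_left t).comp (π.tendsto_pred_nhdsLT hst.pos)))).pow 2
  refine le_of_tendsto_of_tendsto hlim ((h.tendsto_qvApprox_apply hQ (π.tendsto_pred t) j j).sub
    (h.tendsto_qvApprox_apply hQ tendsto_const_nhds j j)) ?_
  filter_upwards [π.eventually_lt_last t, (π.tendsto_pred t).eventually_const_lt hst]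
    with n hlast hpred using π.sq_next_pred_sub_le x j hpred hlast

theorem continuous (h : π.HasQuadVar x Q) (hQ : Continuous Q.toFun) : Continuous x.toFun := by
  refine continuous_iff_continuousAt.2 fun t =>
    continuousAt_iff_continuous_left'_right'.2 ⟨?_, (x.cadlag t).1.mono Ioi_subset_Ici_self⟩
  suffices hjump : x.jump t = 0 by
    simpa [ContinuousWithinAt, ← sub_eq_zero.1 hjump] using x.tendsto_left t
  rcases eq_zero_or_pos t with rfl | ht
  · simp [CadlagPath.jump, x.left_zero]
  ext j
  have hQt : Tendsto (fun s => Q t j j - Q s j j) (𝓝[<] t) (𝓝 0) := by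
    simpa using (((hQ.matrix_elem j j).tendsto t).mono_left nhdsWithin_le_nhds).const_sub (Q t j j)
  have := nhdsLT_neBot_of_exists_lt ⟨0, ht⟩
  have hle : (x.jump t j) ^ 2 ≤ 0 :=
    ge_of_tendsto hQt (eventually_mem_nhdsWithin.mono fun s hs => h.sq_jump_le hQ hs j)
  simpa using hle.antisymm (sq_nonneg _)

theorem apply_diag_eq_zero (h : π.HasQuadVar x Q) (hQ : Continuous Q.toFun) {c K : ℝ≥0}
    (hK : LipschitzOnWith K x.toFun (Iio c)) {s : ℝ≥0} (hs : s < c) (j : Fin m) :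
    Q s j j = 0 := by
  have hlim := h.tendsto_qvApprox_apply hQ (tendsto_const_nhds (x := s)) j j
  have hbound : ∀ η > 0, Q s j j ≤ K ^ 2 * (η : ℝ≥0) * c := by
    refine fun η hη => le_of_tendsto hlim ?_
    filter_upwards [π.mesh s _ (lt_min hη (tsub_pos_of_lt hs))] with n hmesh
    refine π.qvApprox_apply_diag_le x j hK (fun i hi his => ?_) fun i hi his =>
      (hmesh i hi his).le.trans (add_le_add_right (min_le_left _ _) _)
    calc π.t n (i + 1) < π.t n i + min η (c - s) := hmesh i hi his
      _ ≤ s + (c - s) := add_le_add his (min_le_right _ _)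
      _ = c := add_tsub_cancel_of_le hs.le
  have hzero : Tendsto (fun η : ℝ≥0 => (K : ℝ) ^ 2 * η * c) (𝓝[>] 0) (𝓝 0) := by
    refine Tendsto.mono_left ?_ nhdsWithin_le_nhds
    exact Continuous.tendsto' (by fun_prop) _ _ (by simp)
  refine le_antisymm (ge_of_tendsto hzero (eventually_mem_nhdsWithin.mono hbound)) ?_
  refine ge_of_tendsto' hlim fun n => ?_
  rw [qvApprox_apply_diag]
  exact Finset.sum_nonneg fun _ _ => sq_nonneg _

theorem not_lipschitzOnWith (h : π.HasQuadVar x Q) (hQ : Continuous Q.toFun)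
    (hinc : ∀ s t, s < t → (Q t - Q s).PosSemidef ∧ Q s ≠ Q t) {c : ℝ≥0} (hc : 0 < c) (K : ℝ≥0) :
    ¬ LipschitzOnWith K x.toFun (Iio c) := by
  intro hK
  obtain ⟨s, hs, hsc⟩ := exists_between hc
  obtain ⟨hpsd, hne⟩ := hinc 0 s hs
  have htrace : (Q s - Q 0).trace = 0 := Finset.sum_eq_zero fun j _ => by
    rw [Matrix.diag_apply, Matrix.sub_apply, h.apply_diag_eq_zero hQ hK hsc,
      h.apply_diag_eq_zero hQ hK hc, sub_zero]
  exact hne (sub_eq_zero.1 (hpsd.trace_eq_zero_iff.1 htrace)).symm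

theorem not_locallyLipschitz (h : π.HasQuadVar x Q) (hQ : Continuous Q.toFun)
    (hinc : ∀ s t, s < t → (Q t - Q s).PosSemidef ∧ Q s ≠ Q t) :
    ¬ LocallyLipschitz x.toFun := by
  intro hx
  obtain ⟨K, U, hU, hK⟩ := hx 0
  obtain ⟨c, hc, hcU⟩ := NNReal.nhds_zero_basis.mem_iff.1 hU
  exact h.not_lipschitzOnWith hQ hinc hc K (hK.mono hcU)

end PartitionSeq.HasQuadVar

section urysohn

theorem exists_continuousAt_eqOn_zero_eqOn_one {X : Type*} [TopologicalSpace X]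
    [TopologicalSpace.MetrizableSpace X] {A B : Set X} (hA : IsClosed A) (hB : IsClosed B)
    (hA' : A.Nonempty) (hB' : B.Nonempty) :
    ∃ f : X → ℝ, (∀ y ∉ A ∩ B, ContinuousAt f y) ∧ EqOn f 0 A ∧ EqOn f 1 (B \ A) := by
  let := TopologicalSpace.metrizableSpaceMetric X
  refine ⟨fun y => Metric.infDist y A / (Metric.infDist y A + Metric.infDist y B), fun y hy => ?_,
    fun y hy => ?_, fun y hy => ?_⟩
  · have hcont (S : Set X) : ContinuousAt (Metric.infDist · S) y :=
      (Metric.continuous_infDist_pt S).continuousAt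
    refine (hcont A).div ((hcont A).add (hcont B)) fun h0 => hy ?_
    obtain ⟨hyA, hyB⟩ :=
      (add_eq_zero_iff_of_nonneg Metric.infDist_nonneg Metric.infDist_nonneg).1 h0
    exact ⟨(hA.mem_iff_infDist_zero hA').2 hyA, (hB.mem_iff_infDist_zero hB').2 hyB⟩
  · simp [Metric.infDist_zero_of_mem hy]
  · have hyA : Metric.infDist y A ≠ 0 := mt (hA.mem_iff_infDist_zero hA').2 hy.2
    simp [Metric.infDist_zero_of_mem hy.1, hyA]

theorem isClosed_insert_setOf_exists_eqOn {ι E : Type*} [TopologicalSpace E] [T2Space E]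
    {p : ι → E} {a : ℕ → ι → E} {I : ℕ → Set ι} (ha : Tendsto a atTop (𝓝 p))
    (hI : ∀ q, ∀ᶠ n in atTop, q ∈ I n) (s : Set ℕ) :
    IsClosed (insert p {φ | ∃ n ∈ s, EqOn φ (a n) (I n)}) := by
  refine ⟨isOpen_iff_eventually.2 fun φ hφ => ?_⟩
  obtain ⟨hφp, hφa⟩ := not_or.1 hφ
  obtain ⟨q, hq⟩ := Function.ne_iff.1 hφp
  have hne : ∀ᶠ r : ℕ × (ι → E) in atTop ×ˢ 𝓝 φ, r.2 q ≠ a r.1 q :=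
    ((((continuous_apply q).tendsto φ).comp tendsto_snd).prodMk_nhds
      (((continuous_apply q).tendsto p).comp (ha.comp tendsto_fst))).eventually
      ((isOpen_ne_fun continuous_fst continuous_snd).mem_nhds hq)
  obtain ⟨P, hP, P', hP', hPP'⟩ := eventually_prod_iff.1 hne
  obtain ⟨N, hN⟩ := eventually_atTop.1 (hP.and (hI q))
  have hclosed (n : ℕ) : IsClosed {ψ : ι → E | EqOn ψ (a n) (I n)} := by
    simp only [EqOn, ofPred_forall]
    exact isClosed_biInter fun q _ => isClosed_eq (continuous_apply q) continuous_const
  have hfew : ∀ᶠ ψ in 𝓝 φ, ∀ n ∈ Finset.range N, n ∈ s → ¬ EqOn ψ (a n) (I n) := by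
    refine (Finset.eventually_all _).2 fun n _ => eventually_imp_distrib_left.2 fun hns => ?_
    exact (hclosed n).isOpen_compl.mem_nhds fun h => hφa ⟨n, hns, h⟩
  filter_upwards [isOpen_ne.mem_nhds hφp, hfew, hP'] with ψ hψp hψ hψ'
  refine not_or.2 ⟨hψp, fun ⟨n, hns, hn⟩ => ?_⟩
  rcases lt_or_ge n N with hnN | hnN
  · exact hψ n (Finset.mem_range.2 hnN) hns hn
  · exact hPP' (hN n hnN).1 hψ' (hn (hN n hnN).2)

theorem exists_continuousAt_eq_zero_of_eqOn_eq_one {ι E : Type*} [Countable ι] [MetricSpace E]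
    {p : ι → E} {a b : ℕ → ι → E} {I : ℕ → Set ι} {s : Set ℕ}
    (ha : Tendsto a atTop (𝓝 p)) (hb : Tendsto b atTop (𝓝 p)) (hI : ∀ q, ∀ᶠ n in atTop, q ∈ I n)
    (hbp : ∀ k ∈ s, b k ≠ p) (hba : ∀ k ∈ s, ∀ n ∈ s, ¬ EqOn (b k) (a n) (I n)) :
    ∃ f : (ι → E) → ℝ, (∀ φ ≠ p, ContinuousAt f φ) ∧ f p = 0 ∧
      (∀ n ∈ s, ∀ φ, EqOn φ (a n) (I n) → f φ = 0) ∧ ∀ k ∈ s, f (b k) = 1 := by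
  let A := insert p {φ | ∃ n ∈ s, EqOn φ (a n) (I n)}
  let B := insert p {φ | ∃ n ∈ s, EqOn φ (b n) univ}
  have hA : IsClosed A := isClosed_insert_setOf_exists_eqOn ha hI s
  have hB : IsClosed B :=
    isClosed_insert_setOf_exists_eqOn hb (fun q => .of_forall fun _ => mem_univ q) s
  have hbA (k : ℕ) (hk : k ∈ s) : b k ∉ A :=
    not_or.2 ⟨hbp k hk, fun ⟨n, hn, hkn⟩ => hba k hk n hn hkn⟩
  have hAB : A ∩ B ⊆ {p} := by
    rintro φ ⟨hφA, rfl | ⟨k, hk, hφk⟩⟩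
    · rfl
    · exact absurd ((eqOn_univ _ _).1 hφk ▸ hφA) (hbA k hk)
  obtain ⟨f, hf, hfA, hfB⟩ := exists_continuousAt_eqOn_zero_eqOn_one hA hB
    (insert_nonempty _ _) (insert_nonempty _ _)
  exact ⟨f, fun φ hφ => hf φ fun h => hφ (hAB h), hfA (mem_insert _ _),
    fun n hn φ h => hfA (.inr ⟨n, hn, h⟩),
    fun k hk => hfB ⟨.inr ⟨k, hk, fun _ _ => rfl⟩, hbA k hk⟩⟩

end urysohn

section separation

variable {E : Type*} [NormedAddCommGroup E]

theorem CadlagPath.eqOn_Iio_of_dense {x y : CadlagPath E} {D : Set ℝ≥0} (hD : Dense D) {c : ℝ≥0}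
    (h : EqOn x y (D ∩ Iio c)) : EqOn x y (Iio c) := by
  intro s hs
  have hmem : s ∈ closure (Ioo s c ∩ D) := by
    refine closure_minimal (hD.open_subset_closure_inter isOpen_Ioo) isClosed_closure ?_
    rw [closure_Ioo (ne_of_lt hs)]
    exact left_mem_Icc.2 (le_of_lt hs)
  have := mem_closure_iff_nhdsWithin_neBot.1 hmem
  have hlim (z : CadlagPath E) : Tendsto z (𝓝[Ioo s c ∩ D] s) (𝓝 (z s)) :=
    (z.cadlag s).1.tendsto.mono_left (nhdsWithin_mono s fun q hq => hq.1.1.le)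
  exact tendsto_nhds_unique ((hlim x).congr' (eventually_mem_nhdsWithin.mono fun q hq =>
    h ⟨hq.2, hq.1.2⟩)) (hlim y)

namespace PartitionSeq

variable {π : PartitionSeq}

theorem stepApprox_eqOn {n : ℕ} {y z : CadlagPath E} {c : ℝ≥0} (hc : c < π.t n (π.k n))
    (h : EqOn y z (Iio c)) : EqOn (π.stepApprox n y) (π.stepApprox n z) (Iio (π.pred n c)) := by
  intro s hs
  have hlast : s < π.t n (π.k n) := (mem_Iio.1 hs).trans_le ((π.pred_le n c).trans hc.le)
  rw [π.stepApprox_apply y hlast, π.stepApprox_apply z hlast]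
  exact h ((π.lt_pred_iff hlast).1 hs)

theorem finite_image_stepApprox (n : ℕ) (x : CadlagPath E) :
    (π.stepApprox n x '' Iio (π.t n (π.k n))).Finite := by
  refine ((Finset.range (π.k n)).finite_toSet.image fun i => x (π.t n (i + 1))).subset ?_
  rintro _ ⟨s, hs, rfl⟩
  obtain ⟨i, hi, hsi⟩ := π.exists_mem_Ico hs
  exact ⟨i, by simpa using hi, by rw [π.stepApprox_apply x hs, π.next_eq hi hsi]⟩

theorem subsingleton_image_of_eqOn_stepApprox {n : ℕ} {x y : CadlagPath E} {c : ℝ≥0}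
    (hy : Continuous y.toFun) (hc : c ≤ π.t n (π.k n)) (h : EqOn y (π.stepApprox n x) (Iio c)) :
    (y '' Iio c).Subsingleton := by
  refine not_nontrivial_iff.1 fun hnt => ?_
  refine (isPreconnected_Iio.image y.toFun hy.continuousOn).infinite_of_nontrivial hnt ?_
  exact h.image_eq ▸ (π.finite_image_stepApprox n x).subset (image_mono (Iio_subset_Iio hc))

variable {x : CadlagPath E} {z : ℕ → CadlagPath E} {T : ℝ≥0}

theorem exists_forall_not_eqOn_stepApprox (hz : ∀ n, Continuous (z n).toFun)
    (hzx : ∀ s < T, Tendsto (z · s) atTop (𝓝 (x s))) (hx : (x '' Iio T).Nontrivial) :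
    ∃ N, ∀ n ≥ N, ∀ k ≥ N, ¬ EqOn (z k) (π.stepApprox n x) (Iio (π.pred n T)) := by
  obtain ⟨_, ⟨u, hu, rfl⟩, _, ⟨v, hv, rfl⟩, huv⟩ := hx
  have hne : ∀ᶠ k in atTop, z k u ≠ z k v := ((hzx u hu).prodMk_nhds (hzx v hv)).eventually
    ((isOpen_ne_fun continuous_fst continuous_snd).mem_nhds huv)
  obtain ⟨N, hN⟩ := eventually_atTop.1 <| hne.and <| (π.eventually_lt_last T).and <|
    ((π.tendsto_pred T).eventually_const_lt hu).and ((π.tendsto_pred T).eventually_const_lt hv)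
  refine ⟨N, fun n hn k hk h => (hN k hk).1 ?_⟩
  obtain ⟨-, hlast, hun, hvn⟩ := hN n hn
  exact subsingleton_image_of_eqOn_stepApprox (hz k) ((π.pred_le n T).trans hlast.le) h
    ⟨u, hun, rfl⟩ ⟨v, hvn, rfl⟩

/- A path is observed at the points of a countable dense set `D`, so that the paths live in the
metrizable space of functions on `D`. -/
theorem exists_tendsto_stepApprox_eventually_eq_one (hz : ∀ n, Continuous (z n).toFun)
    (hzx : ∀ s < T, Tendsto (z · s) atTop (𝓝 (x s))) (hx : (x '' Iio T).Nontrivial)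
    (hne : ∀ n, ¬ EqOn (z n) x (Iio T)) :
    ∃ M : CadlagPath E → ℝ, (∀ y y' : CadlagPath E, EqOn y y' (Iio T) → M y = M y') ∧
      (∀ y, Tendsto (fun n => M (π.stepApprox n y)) atTop (𝓝 (M y))) ∧
      M x = 0 ∧ ∀ᶠ n in atTop, M (z n) = 1 := by
  obtain ⟨N, hN⟩ := exists_forall_not_eqOn_stepApprox (π := π) hz hzx hx
  obtain ⟨D, hDc, hD⟩ := TopologicalSpace.exists_countable_dense ℝ≥0
  have := (hDc.mono (inter_subset_left (t := Iio T))).to_subtype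
  let obs (y : CadlagPath E) (q : ↥(D ∩ Iio T)) : E := y q
  have hobs {y y' : CadlagPath E} {c : ℝ≥0} (hc : c ≤ T)
      (h : EqOn (obs y) (obs y') {q | (q : ℝ≥0) < c}) : EqOn y y' (Iio c) :=
    CadlagPath.eqOn_Iio_of_dense hD fun q hq => h (x := ⟨q, hq.1, hq.2.trans_le hc⟩) hq.2
  have hobs' {y y' : CadlagPath E} (h : obs y = obs y') : EqOn y y' (Iio T) :=
    hobs le_rfl fun q _ => congrFun h q
  have hstep (y : CadlagPath E) : Tendsto (fun n => obs (π.stepApprox n y)) atTop (𝓝 (obs y)) :=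
    tendsto_pi_nhds.2 fun q => π.tendsto_stepApprox_apply y q
  have hlim : Tendsto (fun n => obs (z n)) atTop (𝓝 (obs x)) :=
    tendsto_pi_nhds.2 fun q => hzx q q.2.2
  obtain ⟨f, hf, hfx, hfa, hfz⟩ := exists_continuousAt_eq_zero_of_eqOn_eq_one (ι := ↥(D ∩ Iio T))
    (I := fun n => {q | (q : ℝ≥0) < π.pred n T}) (s := Ici N) (hstep x) hlim
    (fun q => (π.tendsto_pred T).eventually_const_lt q.2.2) (fun k _ h => hne k (hobs' h))
    fun k hk n hn h => hN n hn k hk (hobs (π.pred_le n T) h)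
  have hloc (y y' : CadlagPath E) (h : EqOn y y' (Iio T)) : f (obs y) = f (obs y') :=
    congrArg f (funext fun q => h q.2.2)
  refine ⟨fun y => f (obs y), hloc, fun y => ?_, hfx,
    (eventually_ge_atTop N).mono fun k hk => hfz k hk⟩
  by_cases hy : EqOn y x (Iio T)
  · refine tendsto_nhds_of_eventually_eq ?_
    filter_upwards [eventually_ge_atTop N, π.eventually_lt_last T] with n hn hlast
    rw [hloc y x hy, hfx]
    exact hfa n hn _ fun q hq => stepApprox_eqOn hlast hy hq
  · exact (hf (obs y) fun h => hy (hobs' h)).tendsto.comp (hstep y)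

end PartitionSeq

end separation

theorem tendsto_stopAt_locUnifTopology {E ι : Type*} [NormedAddCommGroup E] {l : Filter ι}
    {f : ι → CadlagPath E} {z : CadlagPath E} (h : Tendsto f l (@nhds _ (locUnifTopology E) z))
    (t : ℝ≥0) : Tendsto (fun i => (f i).stopAt t) l (@nhds _ (locUnifTopology E) (z.stopAt t)) := by
  refine tendsto_locUnifTopology_iff.2 fun T ε hε => ?_
  filter_upwards [tendsto_locUnifTopology_iff.1 h T ε hε] with i hi s hs
  exact hi (min s t) ((min_le_left s t).trans hs)

theorem nontrivial_image_of_not_lipschitzOnWith {X Y : Type*} [PseudoEMetricSpace X]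
    [PseudoEMetricSpace Y] {f : X → Y} {s : Set X} (h : ¬ LipschitzOnWith 0 f s) :
    (f '' s).Nontrivial := by
  by_contra hs
  refine h fun a ha b hb => ?_
  simp [not_nontrivial_iff.1 hs (mem_image_of_mem f ha) (mem_image_of_mem f hb)]

theorem exists_forall_not_lipschitzOnWith_Iio {Y : Type*} [PseudoEMetricSpace Y] {f : ℝ≥0 → Y}
    (h : ¬ LocallyLipschitz f) : ∃ T, ∀ K, ¬ LipschitzOnWith K f (Iio T) := by
  contrapose! h
  intro t
  obtain ⟨K, hK⟩ := h (t + 1)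
  exact ⟨K, Iio (t + 1), Iio_mem_nhds (lt_add_one t), hK⟩

section comparison

variable {m : ℕ} {π : PartitionSeq} {Ω : Set (CadlagPath (EuclideanSpace ℝ (Fin m)))} {T : ℝ≥0}

/- The factor `t - T` vanishes until the whole of `[0, T)` has been observed. -/
theorem isPiRegular_tsub_mul (hΩ : π.IsGeneric Ω)
    {M : CadlagPath (EuclideanSpace ℝ (Fin m)) → ℝ}
    (hloc : ∀ y z : CadlagPath _, EqOn y z (Iio T) → M y = M z)
    (hM : ∀ y ∈ Ω, Tendsto (fun n => M (π.stepApprox n y)) atTop (𝓝 (M y))) :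
    IsPiRegular π fun p : domain Ω => ((p.1.1 - T : ℝ≥0) : ℝ) * M p.1.2 := by
  have hcont : Continuous fun t : ℝ≥0 => ((t - T : ℝ≥0) : ℝ) :=
    NNReal.continuous_coe.comp (continuous_id.sub continuous_const)
  refine isPiRegular_of_eqOn_Iio hΩ (G := fun t y => ((t - T : ℝ≥0) : ℝ) * M y)
    (fun t y z hyz => ?_) (fun y _ => hcont.mul continuous_const)
    fun y hy t u hu => ((hcont.tendsto t).comp hu).mul (hM y hy)
  rcases le_total t T with htT | hTt
  · simp [tsub_eq_zero_of_le htT]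
  · rw [hloc y z (hyz.mono (Iio_subset_Iio hTt))]

variable {x : CadlagPath (EuclideanSpace ℝ (Fin m))}

theorem exists_continuous_piTopology_not_unifTopologyOn (hΩ : π.IsGeneric Ω) (hx : x ∈ Ω)
    {z : ℕ → CadlagPath (EuclideanSpace ℝ (Fin m))} (hzΩ : ∀ᶠ n in atTop, z n ∈ Ω)
    (hz : ∀ n, Continuous (z n).toFun)
    (hzx : Tendsto z atTop (@nhds _ (locUnifTopology _) x)) (hnt : (x '' Iio T).Nontrivial)
    (hne : ∀ n, ¬ EqOn (z n) x (Iio T)) :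
    ∃ F : domain Ω → ℝ, Continuous[piTopology π Ω, inferInstance] F ∧
      ¬ Continuous[unifTopologyOn Ω, inferInstance] F := by
  have hzx' (s : ℝ≥0) : Tendsto (z · s) atTop (𝓝 (x s)) := by
    refine Metric.tendsto_nhds.2 fun ε hε => ?_
    exact (tendsto_locUnifTopology_iff.1 hzx s ε hε).mono fun n h => by
      simpa only [dist_comm] using h s le_rfl
  obtain ⟨M, hloc, hM, hMx, hMz⟩ :=
    PartitionSeq.exists_tendsto_stepApprox_eventually_eq_one (π := π) hz (fun s _ => hzx' s) hnt hne
  let F (p : domain Ω) : ℝ := ((p.1.1 - T : ℝ≥0) : ℝ) * M p.1.2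
  have hF {y : CadlagPath _} (hy : y ∈ Ω) : evalAt F (T + 1) (y.stopAt (T + 1)) = M y := by
    rw [evalAt_of_mem F (mem_domain_stopAt hy _)]
    have hyT : M (y.stopAt (T + 1)) = M y :=
      hloc _ _ fun s hs => CadlagPath.stopAt_apply_of_le ((le_of_lt hs).trans le_self_add)
    simp [F, hyT]
  refine ⟨F, continuous_piTopology (isPiRegular_tsub_mul hΩ hloc fun y _ => hM y), fun hFU => ?_⟩
  have hlim : Tendsto (fun n => evalAt F (T + 1) ((z n).stopAt (T + 1))) atTop
      (𝓝 (evalAt F (T + 1) (x.stopAt (T + 1)))) :=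
    tendsto_evalAt hFU (mem_domain_stopAt hx _) (hzΩ.mono fun n hn => mem_domain_stopAt hn _)
      tendsto_const_nhds (tendsto_stopAt_locUnifTopology hzx (T + 1))
  rw [hF hx, hMx] at hlim
  refine zero_ne_one (tendsto_nhds_unique hlim (tendsto_nhds_of_eventually_eq ?_))
  filter_upwards [hzΩ, hMz] with n hn hMn
  rw [hF hn, hMn]

theorem exists_continuous_piTopology_not_unifTopologyOn_of_not_locallyLipschitz
    (hΩ : π.IsGeneric Ω) (hx : x ∈ Ω) (hxc : Continuous x.toFun)
    (hlip : ¬ LocallyLipschitz x.toFun) (hlin : ∀ᶠ n in atTop, π.linApprox n x ∈ Ω) :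
    ∃ F : domain Ω → ℝ, Continuous[piTopology π Ω, inferInstance] F ∧
      ¬ Continuous[unifTopologyOn Ω, inferInstance] F := by
  obtain ⟨T, hT⟩ := exists_forall_not_lipschitzOnWith_Iio hlip
  choose K hK using π.exists_lipschitzWith_linApprox x
  refine exists_continuous_piTopology_not_unifTopologyOn hΩ hx hlin (fun n => (hK n).continuous)
    (π.tendsto_linApprox hxc) (nontrivial_image_of_not_lipschitzOnWith (hT 0)) fun n hn => ?_
  refine hT (K n) fun s hs t ht => ?_
  rw [← hn hs, ← hn ht]
  exact hK n s t

end comparison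

end CausalCalculus

theorem mainTheorem5_general {m : ℕ} (π : CausalCalculus.PartitionSeq)
    (Ω : Set (CausalCalculus.CadlagPath (EuclideanSpace ℝ (Fin m)))) (hΩ : π.IsGeneric Ω)
    {x : CausalCalculus.CadlagPath (EuclideanSpace ℝ (Fin m))} (hx : x ∈ Ω)
    (hxc : Continuous x.toFun) (hlip : ¬ LocallyLipschitz x.toFun)
    (hlin : ∀ᶠ n in atTop, π.linApprox n x ∈ Ω) :
    (∀ F : CausalCalculus.domain Ω → ℝ,
      Continuous[CausalCalculus.jOneTopologyOn Ω, inferInstance] F →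
        Continuous[CausalCalculus.piTopology π Ω, inferInstance] F) ∧
    (∃ F : CausalCalculus.domain Ω → ℝ,
      Continuous[CausalCalculus.piTopology π Ω, inferInstance] F ∧
        ¬ Continuous[CausalCalculus.unifTopologyOn Ω, inferInstance] F) ∧
    (∃ F : CausalCalculus.domain Ω → ℝ,
      Continuous[CausalCalculus.unifTopologyOn Ω, inferInstance] F ∧
        ¬ Continuous[CausalCalculus.piTopology π Ω, inferInstance] F) ∧
    CausalCalculus.piTopology π Ω < CausalCalculus.jOneTopologyOn Ω ∧
    ¬ CausalCalculus.piTopology π Ω ≤ CausalCalculus.unifTopologyOn Ω ∧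
    ¬ CausalCalculus.unifTopologyOn Ω ≤ CausalCalculus.piTopology π Ω := by
  have : Nontrivial (EuclideanSpace ℝ (Fin m)) := by
    by_contra hE
    have := not_nontrivial_iff_subsingleton.1 hE
    exact hlip ((funext fun _ => Subsingleton.elim _ _ : (fun _ => 0) = x.toFun) ▸ .const 0)
  have hle := CausalCalculus.piTopology_le_jOneTopologyOn hΩ
  obtain ⟨F, hF, hFU⟩ :=
    CausalCalculus.exists_continuous_piTopology_not_unifTopologyOn_of_not_locallyLipschitz
      hΩ hx hxc hlip hlin
  have hUπ : ¬ CausalCalculus.unifTopologyOn Ω ≤ CausalCalculus.piTopology π Ω :=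
    fun h => hFU (continuous_le_dom h hF)
  have hUJ : CausalCalculus.unifTopologyOn Ω ≤ CausalCalculus.jOneTopologyOn Ω :=
    CausalCalculus.prodTopologyOn_mono CausalCalculus.locUnifTopology_le_jOneTopology Ω
  exact ⟨fun G hG => continuous_le_dom hle hG, ⟨F, hF, hFU⟩,
    CausalCalculus.exists_continuous_unifTopologyOn_not_piTopology hΩ,
    lt_of_le_not_ge hle fun h => hUπ (hUJ.trans h),
    CausalCalculus.not_piTopology_le_unifTopologyOn hΩ, hUπ⟩

theorem mainTheorem5 {m : ℕ} (π : CausalCalculus.PartitionSeq)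
    (Ω : Set (CausalCalculus.CadlagPath (EuclideanSpace ℝ (Fin m)))) (hΩ : π.IsRich Ω) :
    -- every functional continuous for the Skorokhod topology is continuous
    (∀ F : CausalCalculus.domain Ω → ℝ,
      Continuous[CausalCalculus.jOneTopologyOn Ω, inferInstance] F →
        Continuous[CausalCalculus.piTopology π Ω, inferInstance] F) ∧
    -- some continuous functional is not continuous for the uniform topology
    (∃ F : CausalCalculus.domain Ω → ℝ,
      Continuous[CausalCalculus.piTopology π Ω, inferInstance] F ∧
        ¬ Continuous[CausalCalculus.unifTopologyOn Ω, inferInstance] F) ∧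
    -- some functional continuous for the uniform topology is not continuous
    (∃ F : CausalCalculus.domain Ω → ℝ,
      Continuous[CausalCalculus.unifTopologyOn Ω, inferInstance] F ∧
        ¬ Continuous[CausalCalculus.piTopology π Ω, inferInstance] F) ∧
    -- in Mathlib's order on topologies, smaller means finer
    CausalCalculus.piTopology π Ω < CausalCalculus.jOneTopologyOn Ω ∧
    ¬ CausalCalculus.piTopology π Ω ≤ CausalCalculus.unifTopologyOn Ω ∧
    ¬ CausalCalculus.unifTopologyOn Ω ≤ CausalCalculus.piTopology π Ω := by
  obtain ⟨hgen, x, hx, Q, hQ, hQc, hinc, hlin⟩ := hΩ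
  exact mainTheorem5_general π Ω hgen hx (hQ.continuous hQc) (hQ.not_locallyLipschitz hQc hinc)
    (eventually_atTop.2 hlin)
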